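/- Let $d\in\{2,3\}$, let $\Omega\subset\mathbb R^d$ be a polygonal/polyhedral domain (bounded, connected, open, with Lipschitz boundary contained in finitely many hyperplanes), and let $\mathcal T_h$ be a finite partition of $\Omega$ into polygonal/polyhedral domains $T$ of the same kind, with set of edges/flat faces $\mathcal E_h$; write $\mathbf n$ for the outward unit normal on $\partial T$. Let $k\ge 1$ be an integer, and let $P_r(T)$, $P_r(e)$ denote the polynomials of degree at most $r$ on $T$, $e$. For a weak function $\mathbf v=\{\mathbf v_0,\mathbf v_b\}$ on $T$, the discrete weak gradient $\nabla_w\mathbf v\in[P_{k-1}(T)]^{d\times d}$ and the discrete weak divergence $\nabla_w\cdot\mathbf v\in P_{k-1}(T)$ are the unique polynomials with $$(\nabla_w\mathbf v,q)_T=-(\mathbf v_0,\nabla\cdot q)_T+\langle\mathbf v_b,q\mathbf n\rangle_{\partial T}\quad\forall q\in[P_{k-1}(T)]^{d\times d},$$ $$(\nabla_w\cdot\mathbf v,\varphi)_T=-(\mathbf v_0,\nabla\varphi)_T+\langle\mathbf v_b\cdot\mathbf n,\varphi\rangle_{\partial T}\quad\forall\varphi\in P_{k-1}(T),$$ where the gradient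 $(\nabla\mathbf v)_{ij}=\partial_j v_i$ and the divergence $(\nabla\cdot q)_i=\sum_j\partial_jq_{ij}$ are taken row by row. Let $Q_0$ be the $L^2$ projection onto $[P_k(T)]^d$ on each $T\in\mathcal T_h$, let $Q_b$ be the $L^2$ projection from $[L^2(e)]^d$ onto $[P_{k-1}(e)]^d$ on each $e\in\mathcal E_h$, and let $\mathbf Q_h$ and $\mathbb Q_h$ be the $L^2$ projections onto $[P_{k-1}(T)]^{d\times d}$ and $P_{k-1}(T)$ on each $T$. Put $Q_h\mathbf v=\{Q_0\mathbf v,Q_b\mathbf v\}$, where $Q_b$ is applied to the boundary values of $\mathbf v$ on the faces. 1. Every $\mathbf v\in[H^1(\Omega)]^d$ has a trace in $L^2$ on the union of the faces, and with this trace, on every $T\in\mathcal T_h$, $$\nabla_w(Q_h\mathbf v)=\mathbf Q_h(\nabla\mathbf v),\qquad \nabla_w\cdot(Q_h\mathbf v)=\mathbb Q_h(\nabla\cdot\mathbf v).$$ 2. Let $\mathbf v\in H(\mathrm{div},\Omega)$ have square integrable boundary values on the faces, i.e. let there be a field $\mathbf v_b$ with $\mathbf v_b|_e\in[L^2(e)]^d$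 for all $e\in\mathcal E_h$ such that, for every $T\in\mathcal T_h$, the normal trace of $\mathbf v$ on $\partial T$ is $\mathbf v_b\cdot\mathbf n$. Then, with $Q_h\mathbf v=\{Q_0\mathbf v,Q_b\mathbf v_b\}$, on every $T\in\mathcal T_h$, $$\nabla_w\cdot(Q_h\mathbf v)=\mathbb Q_h(\nabla\cdot\mathbf v).$$ -/

import Mathlib

open MeasureTheory Filter Topology
open scoped ContDiff

noncomputable section

namespace WG

/-- The Euclidean space `ℝᵈ`. -/
abbrev E (d : ℕ) : Type := EuclideanSpace ℝ (Fin d)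

/-- Scalar-valued functions on `ℝᵈ`; vector fields are `Fin d → Fld d` and `d × d` matrix fields
are `Fin d → Fin d → Fld d`. -/
abbrev Fld (d : ℕ) : Type := E d → ℝ

/-- The classical partial derivative `∂ⱼ f`. -/
def pd {d : ℕ} (j : Fin d) (f : Fld d) : Fld d :=
  fun x => fderiv ℝ f x (EuclideanSpace.single j 1)

/-- Lebesgue measure on `T`. -/
abbrev vol {d : ℕ} (T : Set (E d)) : Measure (E d) := volume.restrict T

/-- Surface measure: the `(d-1)`-dimensional Hausdorff measure, normalised so as to agree with
Lebesgue measure on hyperplanes, restricted to `S`. -/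
abbrev surf {d : ℕ} (S : Set (E d)) : Measure (E d) :=
  (Measure.euclideanHausdorffMeasure (d - 1) : Measure (E d)).restrict S

/-! ### Polygonal and polyhedral domains -/

/-- `T` has a Lipschitz boundary: near each boundary point, and with respect to a suitable
direction `ν`, `T` is the set of points below the graph of a Lipschitz function `ζ` of the
coordinates orthogonal to `ν`. -/
def HasLipschitzBoundary {d : ℕ} (T : Set (E d)) : Prop :=
  ∀ x ∈ frontier T, ∃ ν : E d, ‖ν‖ = 1 ∧ ∃ r > 0, ∃ (K : NNReal) (ζ : E d → ℝ),
    LipschitzWith K ζ ∧ (∀ y, ∀ t : ℝ, ζ (y + t • ν) = ζ y) ∧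
    ∀ y ∈ Metric.ball x r, y ∈ T ↔ inner ℝ ν y < ζ y

/-- Polygonal (`d = 2`) or polyhedral (`d = 3`) domain: a bounded domain with Lipschitz boundary
which is contained in finitely many hyperplanes. -/
structure IsPolyhedralDomain {d : ℕ} (T : Set (E d)) : Prop where
  isOpen : IsOpen T
  isConnected : IsConnected T
  isBounded : Bornology.IsBounded T
  lipschitz : HasLipschitzBoundary T
  flat : ∃ s : Finset (E d × ℝ), (∀ p ∈ s, p.1 ≠ 0) ∧
    frontier T ⊆ ⋃ p ∈ s, {x | inner ℝ p.1 x = p.2}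

/-- `n` is the outward unit normal of `T` at the flat boundary point `x`: close to `x` the set `T`
is the half space `⟪n, y - x⟫ < 0`. -/
def IsOutwardNormalAt {d : ℕ} (T : Set (E d)) (x n : E d) : Prop :=
  ‖n‖ = 1 ∧ ∀ᶠ y in 𝓝 x, (y ∈ T ↔ inner ℝ n (y - x) < 0)

open Classical in
/-- The outward unit normal field on the boundary of `T` (and `0` at points that are not flat
boundary points; these form a null set in the boundary of a polyhedral domain). -/
def outwardNormal {d : ℕ} (T : Set (E d)) (x : E d) : E d :=
  if h : ∃ n, IsOutwardNormalAt T x n then h.choose else 0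

/-- `e` is an edge / flat face (or a flat part of one) of `T`: a compact subset of the boundary
that lies in a hyperplane and on which the outward unit normal is constant. -/
def IsFlatFace {d : ℕ} (T e : Set (E d)) : Prop :=
  IsCompact e ∧ e ⊆ frontier T ∧ ∃ n : E d, ‖n‖ = 1 ∧ (∃ c : ℝ, ∀ x ∈ e, inner ℝ n x = c) ∧
    ∀ᵐ x ∂(surf e), IsOutwardNormalAt T x n

/-- A finite partition of `Ω` into polygons / polyhedra, with its set of edges / flat faces. The
faces do not overlap, and the boundary of each element is the union of the faces it contains
(hanging nodes are allowed: they split a side into several faces). -/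
structure PolyhedralMesh {d : ℕ} (Ω : Set (E d)) where
  elems : Finset (Set (E d))
  faces : Finset (Set (E d))
  elem_polyhedral : ∀ T ∈ elems, IsPolyhedralDomain T
  elem_subset : ∀ T ∈ elems, T ⊆ Ω
  elem_disjoint : ∀ T ∈ elems, ∀ T' ∈ elems, T ≠ T' → Disjoint T T'
  cover : closure Ω = ⋃ T ∈ elems, closure T
  face_of_elem : ∀ e ∈ faces, ∃ T ∈ elems, e ⊆ frontier T
  face_flat : ∀ T ∈ elems, ∀ e ∈ faces, e ⊆ frontier T → IsFlatFace T e
  face_overlap : ∀ e ∈ faces, ∀ e' ∈ faces, e ≠ e' → surf e e' = 0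
  frontier_eq : ∀ T ∈ elems, frontier T = ⋃ e ∈ {e | e ∈ faces ∧ e ⊆ frontier T}, e

/-- The mesh skeleton: the union of all edges / faces. -/
def PolyhedralMesh.skeleton {d : ℕ} {Ω : Set (E d)} (M : PolyhedralMesh Ω) : Set (E d) :=
  ⋃ e ∈ M.faces, e

/-! ### Sobolev spaces and traces -/

/-- Test functions `C_c^∞(Ω)`. -/
def IsTest {d : ℕ} (Ω : Set (E d)) (φ : Fld d) : Prop :=
  ContDiff ℝ ∞ φ ∧ HasCompactSupport φ ∧ tsupport φ ⊆ Ω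

/-- `v ∈ [H¹(Ω)]ᵈ` with weak gradient `∇v = G`, that is `G i j = ∂ⱼ vᵢ`. -/
structure IsH1 {d : ℕ} (Ω : Set (E d)) (v : Fin d → Fld d) (G : Fin d → Fin d → Fld d) :
    Prop where
  memLp : ∀ i, MemLp (v i) 2 (vol Ω)
  memLp_grad : ∀ i j, MemLp (G i j) 2 (vol Ω)
  weak : ∀ i j, ∀ φ : Fld d, IsTest Ω φ →
    ∫ x in Ω, v i x * pd j φ x = - ∫ x in Ω, G i j x * φ x

/-- `v ∈ H(div, Ω)` with weak divergence `∇ · v = D`. -/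
structure IsHdiv {d : ℕ} (Ω : Set (E d)) (v : Fin d → Fld d) (D : Fld d) : Prop where
  memLp : ∀ i, MemLp (v i) 2 (vol Ω)
  memLp_div : MemLp D 2 (vol Ω)
  weak : ∀ φ : Fld d, IsTest Ω φ →
    ∫ x in Ω, (∑ i, v i x * pd i φ x) = - ∫ x in Ω, D x * φ x

/-- `f m → g` in `L²(μ)`. -/
def TendstoL2 {d : ℕ} (μ : Measure (E d)) (f : ℕ → Fld d) (g : Fld d) : Prop :=
  Tendsto (fun m => eLpNorm (fun x => f m x - g x) 2 μ) atTop (𝓝 0)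

/-- For `v ∈ [H¹(Ω)]ᵈ` with gradient `G`: the field `vb ∈ [L²(S)]ᵈ` is the trace of `v` on the
surface `S`, i.e. the value at `v` of the extension by continuity, from smooth functions to `H¹`,
of the restriction to `S`. -/
def IsTrace {d : ℕ} (Ω S : Set (E d)) (v : Fin d → Fld d) (G : Fin d → Fin d → Fld d)
    (vb : Fin d → Fld d) : Prop :=
  ∀ i, MemLp (vb i) 2 (surf S) ∧ ∃ φ : ℕ → Fld d, (∀ m, ContDiff ℝ ∞ (φ m)) ∧
    TendstoL2 (vol Ω) φ (v i) ∧ (∀ j, TendstoL2 (vol Ω) (fun m => pd j (φ m)) (G i j)) ∧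
    TendstoL2 (surf S) φ (vb i)

/-- For `v ∈ H(div, T)` with divergence `D`: the normal trace `v · n` on `∂T`, defined as the
extension by continuity of `φ ↦ φ · n` from smooth fields to `H(div, T)` with values in the
distributions on `∂T`, is the function `vb · n`. -/
def IsNormalTrace {d : ℕ} (T : Set (E d)) (v : Fin d → Fld d) (D : Fld d)
    (vb : Fin d → Fld d) : Prop :=
  ∃ φ : ℕ → Fin d → Fld d, (∀ m i, ContDiff ℝ ∞ (φ m i)) ∧
    (∀ i, TendstoL2 (vol T) (fun m => φ m i) (v i)) ∧
    TendstoL2 (vol T) (fun m x => ∑ i, pd i (φ m i) x) D ∧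
    ∀ ψ : Fld d, IsTest Set.univ ψ →
      Tendsto (fun m => ∫ x, (∑ i, φ m i x * outwardNormal T x i) * ψ x ∂(surf (frontier T)))
        atTop (𝓝 (∫ x, (∑ i, vb i x * outwardNormal T x i) * ψ x ∂(surf (frontier T))))

/-! ### Polynomials and `L²` projections -/

/-- The function on `ℝᵈ` defined by a polynomial, as a linear map. -/
def evalLin (d : ℕ) : MvPolynomial (Fin d) ℝ →ₗ[ℝ] Fld d where
  toFun p := fun x => MvPolynomial.eval (fun i => x i) p
  map_add' p q := by ext x; simp
  map_smul' c p := by ext x; simp [MvPolynomial.smul_eval]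

/-- Polynomial functions of total degree at most `r`. -/
def Poly (d r : ℕ) : Submodule ℝ (Fld d) :=
  (MvPolynomial.restrictTotalDegree (Fin d) ℝ r).map (evalLin d)

/-- `p` is an `L²(μ)` projection of `f` onto the polynomials of degree at most `r`. -/
def IsL2Proj {d : ℕ} (μ : Measure (E d)) (r : ℕ) (f p : Fld d) : Prop :=
  p ∈ Poly d r ∧ ∀ q ∈ Poly d r, ∫ x, (f x - p x) * q x ∂μ = 0

instance instNonemptyFld (d : ℕ) : Nonempty (Fld d) := ⟨0⟩

/-- The `L²(μ)` projection of `f` onto the polynomials of degree at most `r` (a polynomial that is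
determined `μ`-almost everywhere). -/
def l2Proj {d : ℕ} (μ : Measure (E d)) (r : ℕ) (f : Fld d) : Fld d :=
  Classical.epsilon (IsL2Proj μ r f)

/-- The projection exists. -/
theorem l2Proj_spec {d : ℕ} {μ : Measure (E d)} {r : ℕ} {f : Fld d} (hf : MemLp f 2 μ)
    (hP : ∀ q ∈ Poly d r, MemLp q 2 μ) : IsL2Proj μ r f (l2Proj μ r f) := by
  refine Classical.epsilon_spec (p := IsL2Proj μ r f) ?_
  let L : Poly d r →ₗ[ℝ] Lp ℝ 2 μ :=
    { toFun := fun q => (hP q.1 q.2).toLp q.1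
      map_add' := fun _ _ => rfl
      map_smul' := fun _ _ => rfl }
  have : Module.Finite ℝ (Poly d r) :=
    Module.Finite.map (MvPolynomial.restrictTotalDegree (Fin d) ℝ r) (evalLin d)
  obtain ⟨p, hp⟩ : (L.range.starProjection (hf.toLp f)) ∈ L.range :=
    Submodule.starProjection_apply_mem _ _
  refine ⟨p.1, p.2, fun q hq => ?_⟩
  have h := Submodule.starProjection_inner_eq_zero (K := L.range) (hf.toLp f) (L ⟨q, hq⟩) ⟨_, rfl⟩
  rw [← hp, L2.inner_def] at h
  rw [← h]
  refine integral_congr_ae ?_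
  filter_upwards [Lp.coeFn_sub (hf.toLp f) (L p), hf.coeFn_toLp, (hP p.1 p.2).coeFn_toLp,
    (hP q hq).coeFn_toLp] with x h1 h2 h3 h4
  have h3' : (L p : E d → ℝ) x = p.1 x := h3
  have h4' : (L ⟨q, hq⟩ : E d → ℝ) x = q x := h4
  simp only [h1, Pi.sub_apply, h2, h3', h4', RCLike.inner_apply, conj_trivial]
  ring

/-- `Q₀` on the element `T`: the projection onto `[P_k(T)]ᵈ`. -/
def projElem {d : ℕ} (T : Set (E d)) (k : ℕ) (v : Fin d → Fld d) : Fin d → Fld d :=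
  fun i => l2Proj (vol T) k (v i)

/-- `Q_b`: the projection, on each edge / face `e`, onto `[P_r(e)]ᵈ`, as a field on the skeleton
(faces overlap in null sets only). -/
def PolyhedralMesh.projFaces {d : ℕ} {Ω : Set (E d)} (M : PolyhedralMesh Ω) (r : ℕ)
    (vb : Fin d → Fld d) : Fin d → Fld d :=
  fun i x => ∑ e ∈ M.faces, e.indicator (l2Proj (surf e) r (vb i)) x

/-- The projection onto `[P_r(T)]^{d×d}`. -/
def projMatrix {d : ℕ} (T : Set (E d)) (r : ℕ) (G : Fin d → Fin d → Fld d) :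
    Fin d → Fin d → Fld d :=
  fun i j => l2Proj (vol T) r (G i j)

/-! ### Discrete weak operators -/

/-- `A ∈ [P_r(T)]^{d×d}` is the discrete weak gradient on `T` of the weak function `{v₀, vb}`:
`(A, q)_T = -(v₀, ∇·q)_T + ⟨vb, q·n⟩_{∂T}` for all `q ∈ [P_r(T)]^{d×d}`. -/
def IsDiscreteWeakGradient {d : ℕ} (T : Set (E d)) (r : ℕ) (v₀ vb : Fin d → Fld d)
    (A : Fin d → Fin d → Fld d) : Prop :=
  (∀ i j, A i j ∈ Poly d r) ∧
  ∀ q : Fin d → Fin d → Fld d, (∀ i j, q i j ∈ Poly d r) →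
    ∫ x in T, (∑ i, ∑ j, A i j x * q i j x) =
      - (∫ x in T, ∑ i, v₀ i x * ∑ j, pd j (q i j) x) +
      ∫ x, (∑ i, vb i x * ∑ j, q i j x * outwardNormal T x j) ∂(surf (frontier T))

/-- `p ∈ P_r(T)` is the discrete weak divergence on `T` of the weak function `{v₀, vb}`:
`(p, φ)_T = -(v₀, ∇φ)_T + ⟨vb·n, φ⟩_{∂T}` for all `φ ∈ P_r(T)`. -/
def IsDiscreteWeakDivergence {d : ℕ} (T : Set (E d)) (r : ℕ) (v₀ vb : Fin d → Fld d)
    (p : Fld d) : Prop :=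
  p ∈ Poly d r ∧
  ∀ φ ∈ Poly d r,
    ∫ x in T, p x * φ x =
      - (∫ x in T, ∑ i, v₀ i x * pd i φ x) +
      ∫ x, (∑ i, vb i x * outwardNormal T x i) * φ x ∂(surf (frontier T))

end WG

end

noncomputable section

namespace WG

variable {d : ℕ}

/-! ### Hyperplanes and surface measure -/

/-! Integration by parts on an element `T` expresses the moments of `∇v` (or `∇·v`) against
polynomials of degree `k - 1` through moments of `v` in `T` and of its boundary values on `∂T`. In
the interior term `v` is tested with `∂ⱼq`, which lies in `P_k`, so `Q₀v` gives the same value. On a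
face the normal is constant, so the boundary value is tested with a polynomial of degree at most `k
- 1`, and `Q_b` gives the same value. What remains is the functional defining the discrete weak
operator at `Q_h v`. Hence the weak derivative and the projected derivative have equal moments, and
`eq_l2Proj_iff` says that moments determine the polynomial.

The analytic work lies in integrating by parts for nonsmooth `v` and in producing traces.

For smooth functions the divergence theorem is derived from Fubini (`FlatBoundary.integral_fderiv`).
If `ν` is transversal to all faces, then on almost every line parallel to `ν` the indicator of `T`
equals a signed sum of jumps at the face crossings (`indicator_eq`). Multiplying by `∂_ν f` and
integrating, each face `e` contributes `⟪n e, ν⟫ ∫_e f`. Both sides are linear in `ν`, and finitely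
many hyperplanes do not fill the space, so the identity extends to every `ν`.

Applied to `φ² χ` with directions locally pointing out of a Lipschitz domain, the divergence theorem
yields the trace inequality. Smooth functions are dense in `H¹(Ω)` by localised mollification with
kernels shifted into the domain (`exists_smooth_tendstoL2`). Restrictions of smooth approximations
are therefore Cauchy in `L²` of the skeleton, which gives the trace, and integration by parts passes
to the limit. For `H(div)` the limit formula follows directly from the smooth fields that define the
normal trace. -/

/-- The hyperplane `⟪n, x⟫ = c`. -/
def hyperplane (n : E d) (c : ℝ) : Set (E d) := {x | inner ℝ n x = c}

theorem isClosed_hyperplane (n : E d) (c : ℝ) : IsClosed (hyperplane n c) :=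
  isClosed_eq (by fun_prop) continuous_const

theorem isometry_coe_add (n p : E d) :
    Isometry (fun y : (ℝ ∙ n)ᗮ => (y : E d) + p) :=
  Isometry.of_dist_eq fun x y => by simp [Subtype.dist_eq]

theorem range_coe_add_smul {n : E d} (hn : ‖n‖ = 1) (c : ℝ) :
    Set.range (fun y : (ℝ ∙ n)ᗮ => (y : E d) + c • n) = hyperplane n c := by
  ext x
  constructor
  · rintro ⟨y, rfl⟩
    have := Submodule.mem_orthogonal_singleton_iff_inner_right.1 y.2
    simp [hyperplane, inner_add_right, this, inner_smul_right, hn]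
  · intro hx
    refine ⟨⟨x - c • n, ?_⟩, by simp⟩
    rw [Submodule.mem_orthogonal_singleton_iff_inner_right]
    have hx : inner ℝ n x = c := hx
    simp [inner_sub_right, inner_smul_right, hn, hx]

/-- Translating `nᗮ` by `c • n` is an isometry, and Euclidean Hausdorff measure in the full
dimension `d - 1` of `nᗮ` is Lebesgue measure. This makes Fubini and finiteness on compact faces
available for surface measure. -/
theorem surf_hyperplane_eq_map {n : E d} (hn : ‖n‖ = 1) (c : ℝ) :
    surf (hyperplane n c) =
      (volume : Measure (ℝ ∙ n)ᗮ).map (fun y : (ℝ ∙ n)ᗮ => (y : E d) + c • n) := by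
  have hn0 : n ≠ 0 := by rintro rfl; simp at hn
  have hrank : Module.finrank ℝ (ℝ ∙ n)ᗮ = d - 1 := by
    have := (ℝ ∙ n).finrank_add_finrank_orthogonal
    rw [finrank_span_singleton hn0, finrank_euclideanSpace_fin] at this
    omega
  rw [← InnerProductSpace.euclideanHausdorffMeasure_eq_volume, hrank,
    (isometry_coe_add n _).map_euclideanHausdorffMeasure, range_coe_add_smul hn]

theorem sFinite_surf_hyperplane {n : E d} (hn : ‖n‖ = 1) (c : ℝ) :
    SFinite (surf (hyperplane n c)) := by
  rw [surf_hyperplane_eq_map hn]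
  infer_instance

theorem surf_lt_top_of_isCompact {n : E d} (hn : ‖n‖ = 1) {c : ℝ} {e : Set (E d)}
    (he : IsCompact e) (hec : e ⊆ hyperplane n c) :
    (Measure.euclideanHausdorffMeasure (d - 1) : Measure (E d)) e < ⊤ := by
  have h : surf (hyperplane n c) e < ⊤ := by
    rw [surf_hyperplane_eq_map hn, Measure.map_apply (by fun_prop) he.measurableSet]
    exact ((isometry_coe_add n (c • n)).isClosedEmbedding.isCompact_preimage he).measure_lt_top
  rwa [Measure.restrict_apply he.measurableSet, Set.inter_eq_left.2 hec] at h

/-- Fubini's theorem along a direction `ν` transversal to a hyperplane. -/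
theorem volume_eq_smul_map_prod {n ν : E d} (hn : ‖n‖ = 1) (c : ℝ) (ha : inner ℝ n ν ≠ 0) :
    (volume : Measure (E d)) = ENNReal.ofReal |inner ℝ n ν| •
      ((surf (hyperplane n c)).prod volume).map (fun p : E d × ℝ => p.1 + p.2 • ν) := by
  have := sFinite_surf_hyperplane hn c
  have hn0 : n ≠ 0 := by rintro rfl; simp at hn
  set a : ℝ := inner ℝ n ν with ha'
  ext t ht
  have hm : Measurable (fun p : E d × ℝ => p.1 + p.2 • ν) := by fun_prop
  have key := EuclideanGeometry.euclideanHausdorffMeasure_eq_lintegral (P := E d) (0 : E d) hn0 ht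
  rw [finrank_euclideanSpace_fin, EuclideanSpace.euclideanHausdorffMeasure_eq_volume] at key
  rw [key, Measure.smul_apply, Measure.map_apply hm ht, Measure.prod_apply_symm (hm ht)]
  have hplane : ∀ x : ℝ, (AffineSubspace.mk' (x • n +ᵥ (0 : E d)) (ℝ ∙ n)ᗮ : Set (E d)) =
      hyperplane n x := by
    intro x
    ext y
    rw [SetLike.mem_coe, AffineSubspace.mem_mk', Submodule.mem_orthogonal_singleton_iff_inner_right]
    simp [hyperplane, inner_sub_right, inner_smul_right, hn, sub_eq_zero]
  set F : ℝ → ENNReal := fun x => Measure.euclideanHausdorffMeasure (d - 1) (t ∩ hyperplane n x)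
    with hF
  -- Translation by `s • ν` carries level `c` isometrically onto level `c + a * s`, so oblique
  -- slices have the measure of the perpendicular slices in `key`.
  have hFs : ∀ s : ℝ, surf (hyperplane n c) ((fun y => (y, s)) ⁻¹' ((fun p : E d × ℝ =>
      p.1 + p.2 • ν) ⁻¹' t)) = F (c + a * s) := by
    intro s
    have hms : Measurable (fun y : E d => y + s • ν) := by fun_prop
    rw [Measure.restrict_apply (by exact hms ht)]
    have himg : (fun y : E d => y + s • ν) '' ((fun y : E d => y + s • ν) ⁻¹' t ∩ hyperplane n c) =
        t ∩ hyperplane n (c + a * s) := by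
      ext y
      constructor
      · rintro ⟨z, ⟨hz, hzc⟩, rfl⟩
        refine ⟨hz, ?_⟩
        have hzc : inner ℝ n z = c := hzc
        simp [hyperplane, inner_add_right, inner_smul_right, hzc, ← ha', mul_comm]
      · rintro ⟨hy, hyc⟩
        refine ⟨y - s • ν, ⟨by simpa using hy, ?_⟩, by simp⟩
        have hyc : inner ℝ n y = c + a * s := hyc
        simp [hyperplane, inner_sub_right, inner_smul_right, hyc, ← ha', mul_comm]
    have hiso : Isometry (fun y : E d => y + s • ν) := Isometry.of_dist_eq fun x y => by simp
    have := hiso.euclideanHausdorffMeasure_image (d := d - 1)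
      ((fun y : E d => y + s • ν) ⁻¹' t ∩ hyperplane n c)
    rw [himg] at this
    exact this.symm
  simp_rw [hFs, hplane]
  -- The substitution `x = c + a * s` is the source of the Jacobian `|⟪n, ν⟫|`.
  have hscale : ∫⁻ x, F x = ENNReal.ofReal |a| * ∫⁻ s, F (c + a * s) := by
    have h1 : ∫⁻ x, F x = ∫⁻ x, F (c + x) := (lintegral_add_left_eq_self F c).symm
    have h2 := Real.smul_map_volume_mul_left ha
    have h3 : ∫⁻ s, F (c + a * s) = ∫⁻ x, F (c + x) ∂(volume.map (a * ·)) :=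
      ((Homeomorph.mulLeft₀ a ha).measurableEmbedding.lintegral_map (fun x => F (c + x))).symm
    rw [h1, h3, ← smul_eq_mul, ← lintegral_smul_measure, h2]
  have hn' : ‖n‖ₑ = 1 := by
    rw [← ofReal_norm, hn, ENNReal.ofReal_one]
  rw [hn', one_mul, smul_eq_mul]
  exact hscale

/-! ### Lines transversal to the boundary -/

/-- The parameter at which the line through `x` in direction `ν` meets the hyperplane
`⟪n, y⟫ = c`. -/
def crossing (n ν : E d) (c : ℝ) (x : E d) : ℝ := (c - inner ℝ n x) / inner ℝ n ν

/-- The point in which the line through `x` in direction `ν` meets the hyperplane `⟪n, y⟫ = c`. -/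
def foot (n ν : E d) (c : ℝ) (x : E d) : E d := x + crossing n ν c x • ν

theorem continuous_crossing (n ν : E d) (c : ℝ) : Continuous (crossing n ν c) := by
  unfold crossing
  fun_prop

theorem continuous_foot (n ν : E d) (c : ℝ) : Continuous (foot n ν c) := by
  unfold foot
  exact continuous_id.add ((continuous_crossing n ν c).smul continuous_const)

theorem crossing_add_smul {n ν : E d} {c : ℝ} (ha : inner ℝ n ν ≠ 0) (x : E d) (t : ℝ) :
    crossing n ν c (x + t • ν) = crossing n ν c x - t := by
  simp only [crossing, inner_add_right, inner_smul_right]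
  field_simp
  ring

theorem foot_add_smul {n ν : E d} {c : ℝ} (ha : inner ℝ n ν ≠ 0) (x : E d) (t : ℝ) :
    foot n ν c (x + t • ν) = foot n ν c x := by
  simp only [foot, crossing_add_smul ha, sub_smul]
  abel

theorem crossing_of_mem {n ν y : E d} {c : ℝ} (hy : y ∈ hyperplane n c) :
    crossing n ν c y = 0 := by
  have hy : inner ℝ n y = c := hy
  simp [crossing, hy]

theorem foot_of_mem {n ν y : E d} {c : ℝ} (hy : y ∈ hyperplane n c) : foot n ν c y = y := by
  simp [foot, crossing_of_mem hy]

theorem crossing_eq_of_add_smul_mem {n ν x : E d} {c t : ℝ} (ha : inner ℝ n ν ≠ 0)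
    (h : x + t • ν ∈ hyperplane n c) : crossing n ν c x = t := by
  have := crossing_of_mem (ν := ν) h
  rw [crossing_add_smul ha] at this
  linarith

/-- In the product coordinates of `volume_eq_smul_map_prod` the foot map is almost everywhere the
first projection. Exceptional null sets on a face are thus met only by a null set of lines. -/
theorem quasiMeasurePreserving_foot {n ν : E d} (hn : ‖n‖ = 1) (c : ℝ) (ha : inner ℝ n ν ≠ 0) :
    Measure.QuasiMeasurePreserving (foot n ν c) volume (surf (hyperplane n c)) := by
  have := sFinite_surf_hyperplane hn c
  refine ⟨(continuous_foot n ν c).measurable, ?_⟩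
  have hm : Measurable (fun p : E d × ℝ => p.1 + p.2 • ν) := by fun_prop
  rw [volume_eq_smul_map_prod hn c ha, Measure.map_smul,
    Measure.map_map (continuous_foot n ν c).measurable hm]
  refine Measure.AbsolutelyContinuous.smul_left ?_ _
  have hae : ∀ᵐ p ∂((surf (hyperplane n c)).prod (volume : Measure ℝ)),
      p.1 ∈ hyperplane n c :=
    Measure.quasiMeasurePreserving_fst.ae
      (ae_restrict_mem (isClosed_hyperplane n c).measurableSet)
  have hfst : (foot n ν c ∘ fun p : E d × ℝ => p.1 + p.2 • ν) =ᵐ[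
      (surf (hyperplane n c)).prod (volume : Measure ℝ)] Prod.fst := by
    filter_upwards [hae] with p hp
    simp [foot_add_smul ha, foot_of_mem hp]
  rw [Measure.map_congr hfst]
  exact Measure.quasiMeasurePreserving_fst.absolutelyContinuous

/-- The data of a bounded open set whose boundary is a finite union of non-overlapping flat pieces
`e`, contained in `⟪n e, x⟫ = c e` and with outward unit normal `n e` almost everywhere. -/
structure FlatBoundary (T : Set (E d)) (F : Finset (Set (E d))) (n : Set (E d) → E d)
    (c : Set (E d) → ℝ) : Prop where
  isOpen : IsOpen T
  isBounded : Bornology.IsBounded T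
  isCompact : ∀ e ∈ F, IsCompact e
  norm_eq : ∀ e ∈ F, ‖n e‖ = 1
  subset : ∀ e ∈ F, e ⊆ hyperplane (n e) (c e)
  normal : ∀ e ∈ F, ∀ᵐ x ∂(surf e), IsOutwardNormalAt T x (n e)
  overlap : ∀ e ∈ F, ∀ e' ∈ F, e' ≠ e → surf e e' = 0
  frontier_eq : frontier T = ⋃ e ∈ F, e

/-- The jump at `t` from `0` to `1`, right or left continuous according to the sign of `a`. -/
def jump (a t s : ℝ) : ℝ := if t < s ∨ (0 < a ∧ t = s) then 1 else 0

theorem jump_eventually_eq {a t s : ℝ} (h : t ≠ s) : ∀ᶠ r in 𝓝 s, jump a t r = jump a t s := by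
  rcases lt_or_gt_of_ne h with h | h
  · filter_upwards [lt_mem_nhds h] with r hr
    simp [jump, h, hr]
  · filter_upwards [gt_mem_nhds h] with r hr
    simp [jump, h.not_gt, hr.not_gt, h.ne', hr.ne']

theorem jump_zero_of_lt {a t s : ℝ} (h : s < t) : jump a t s = 0 := by
  simp [jump, h.not_gt, h.ne']

theorem isClosedEmbedding_add_smul {ν : E d} (hν : ν ≠ 0) (x : E d) :
    IsClosedEmbedding (fun t : ℝ => x + t • ν) :=
  (Homeomorph.addLeft x).isClosedEmbedding.comp (isClosedEmbedding_smul_left hν)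

open Classical in
/-- Away from a null set, the indicator function of `T` is a signed sum of indicator functions of
half-infinite cylinders over the faces. -/
theorem FlatBoundary.indicator_eq {T : Set (E d)} {F : Finset (Set (E d))} {n : Set (E d) → E d}
    {c : Set (E d) → ℝ} (h : FlatBoundary T F n c) {ν : E d} (hν : ν ≠ 0)
    (ha : ∀ e ∈ F, inner ℝ (n e) ν ≠ 0) :
    ∀ᵐ x : E d, T.indicator (fun _ => (1 : ℝ)) x = - ∑ e ∈ F,
      if foot (n e) ν (c e) x ∈ e then
        (SignType.sign (inner ℝ (n e) ν) : ℝ) * jump (inner ℝ (n e) ν) (crossing (n e) ν (c e) x) 0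
      else 0 := by
  -- Almost every line crosses the boundary only at flat points, each belonging to a single face.
  have hgood : ∀ᵐ x : E d, ∀ e ∈ F, foot (n e) ν (c e) x ∈ e →
      IsOutwardNormalAt T (foot (n e) ν (c e) x) (n e) ∧
      ∀ e' ∈ F, e' ≠ e → foot (n e) ν (c e) x ∉ e' := by
    rw [Filter.eventually_all_finset]
    intro e he
    have hem := (h.isCompact e he).measurableSet
    refine (quasiMeasurePreserving_foot (h.norm_eq e he) (c e) (ha e he)).ae (p := fun y =>
      y ∈ e → IsOutwardNormalAt T y (n e) ∧ ∀ e' ∈ F, e' ≠ e → y ∉ e') ?_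
    refine ae_restrict_of_ae ?_
    rw [← ae_restrict_iff' hem]
    refine (h.normal e he).and ?_
    rw [Filter.eventually_all_finset]
    intro e' he'
    by_cases hee : e' = e
    · simp [hee]
    · have : ∀ᵐ y ∂(surf e), y ∉ e' := measure_eq_zero_iff_ae_notMem.1 (h.overlap e he e' he' hee)
      filter_upwards [this] with y hy _ using hy
  filter_upwards [hgood] with x hx
  -- The indicator along the line with all its jumps compensated. It is locally constant, hence
  -- constant, and it vanishes near `-∞`; its value at `0` is the claim.
  set J : ℝ → ℝ := fun s => T.indicator (fun _ => (1 : ℝ)) (x + s • ν) + ∑ e ∈ F,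
      if foot (n e) ν (c e) x ∈ e then
        (SignType.sign (inner ℝ (n e) ν) : ℝ) * jump (inner ℝ (n e) ν) (crossing (n e) ν (c e) x) s
      else 0 with hJ
  have hline : Continuous (fun s : ℝ => x + s • ν) := by fun_prop
  have hJc : IsLocallyConstant J := by
    rw [IsLocallyConstant.iff_eventually_eq]
    intro s
    -- the summands of faces that are not met at parameter `s`
    have hterm : ∀ e ∈ F, (foot (n e) ν (c e) x ∈ e → crossing (n e) ν (c e) x ≠ s) →
        ∀ᶠ r in 𝓝 s, (if foot (n e) ν (c e) x ∈ e then
          (SignType.sign (inner ℝ (n e) ν) : ℝ) *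
            jump (inner ℝ (n e) ν) (crossing (n e) ν (c e) x) r else 0) =
          (if foot (n e) ν (c e) x ∈ e then
          (SignType.sign (inner ℝ (n e) ν) : ℝ) *
            jump (inner ℝ (n e) ν) (crossing (n e) ν (c e) x) s else 0) := by
      intro e he hes
      by_cases hf : foot (n e) ν (c e) x ∈ e
      · filter_upwards [jump_eventually_eq (a := inner ℝ (n e) ν) (hes hf)] with r hr
        rw [hr]
      · simp [hf]
    by_cases hs : x + s • ν ∈ frontier T
    · rw [h.frontier_eq] at hs
      simp only [Set.mem_iUnion] at hs
      obtain ⟨e, he, hse⟩ := hs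
      have hcr : crossing (n e) ν (c e) x = s :=
        crossing_eq_of_add_smul_mem (ha e he) (h.subset e he hse)
      have hft : foot (n e) ν (c e) x = x + s • ν := by rw [foot, hcr]
      obtain ⟨⟨-, hnorm⟩, hoth⟩ := hx e he (hft ▸ hse)
      rw [hft] at hnorm hoth
      have hrest : ∀ᶠ r in 𝓝 s, ∀ e' ∈ F.erase e, (if foot (n e') ν (c e') x ∈ e' then
          (SignType.sign (inner ℝ (n e') ν) : ℝ) *
            jump (inner ℝ (n e') ν) (crossing (n e') ν (c e') x) r else 0) =
          (if foot (n e') ν (c e') x ∈ e' then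
          (SignType.sign (inner ℝ (n e') ν) : ℝ) *
            jump (inner ℝ (n e') ν) (crossing (n e') ν (c e') x) s else 0) := by
        rw [Filter.eventually_all_finset]
        intro e' he'
        obtain ⟨hne, heF⟩ := Finset.mem_erase.1 he'
        refine hterm e' heF fun hf hcr' => hoth e' heF hne ?_
        rwa [foot, hcr'] at hf
      have hlocal : ∀ᶠ r in 𝓝 s, (x + r • ν ∈ T ↔ (r - s) * inner ℝ (n e) ν < 0) := by
        filter_upwards [hline.continuousAt.eventually hnorm] with r hr
        rw [hr]
        have : x + r • ν - (x + s • ν) = (r - s) • ν := by rw [sub_smul]; abel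
        rw [this, inner_smul_right]
      have hs0 := hlocal.self_of_nhds
      filter_upwards [hrest, hlocal] with r hr hT
      simp only [hJ]
      rw [← Finset.add_sum_erase F _ he, ← Finset.add_sum_erase F _ he, Finset.sum_congr rfl hr]
      rw [← add_assoc, ← add_assoc]
      congr 1
      rw [if_pos (hft ▸ hse), if_pos (hft ▸ hse), hcr]
      have hsT : x + s • ν ∉ T := by rw [hs0]; simp
      rw [Set.indicator_of_notMem hsT]
      -- For `a < 0` the line enters `T` after `s`, for `a > 0` it leaves at `s`. Since `T` is open,
      -- `x + s • ν` is outside in both cases; the one-sided convention in `jump` makes the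
      -- compensation exact at `s` too.
      rcases lt_or_gt_of_ne (ha e he) with hneg | hpos
      · rw [sign_neg hneg]
        by_cases hrs : s < r
        · have : x + r • ν ∈ T := by rw [hT]; nlinarith
          simp [this, jump, hrs, hneg.not_gt]
        · have : x + r • ν ∉ T := by rw [hT]; nlinarith
          simp [this, jump, hrs, hneg.not_gt]
      · rw [sign_pos hpos]
        by_cases hrs : r < s
        · have : x + r • ν ∈ T := by rw [hT]; nlinarith
          simp [this, jump, hrs.not_gt, hrs.ne', hpos]
        · have : x + r • ν ∉ T := by rw [hT]; nlinarith
          simp [this, jump, (le_iff_lt_or_eq.1 (not_lt.1 hrs)), hpos]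
    · have hrest : ∀ᶠ r in 𝓝 s, ∀ e' ∈ F, (if foot (n e') ν (c e') x ∈ e' then
          (SignType.sign (inner ℝ (n e') ν) : ℝ) *
            jump (inner ℝ (n e') ν) (crossing (n e') ν (c e') x) r else 0) =
          (if foot (n e') ν (c e') x ∈ e' then
          (SignType.sign (inner ℝ (n e') ν) : ℝ) *
            jump (inner ℝ (n e') ν) (crossing (n e') ν (c e') x) s else 0) := by
        rw [Filter.eventually_all_finset]
        intro e' he'
        refine hterm e' he' fun hf hcr' => hs ?_
        rw [h.frontier_eq]
        rw [foot, hcr'] at hf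
        exact Set.mem_biUnion he' hf
      have hT : ∀ᶠ r in 𝓝 s, (x + r • ν ∈ T ↔ x + s • ν ∈ T) := by
        by_cases hsT : x + s • ν ∈ T
        · filter_upwards [hline.continuousAt.eventually (h.isOpen.mem_nhds hsT)] with r hr
          exact iff_of_true hr hsT
        · have : x + s • ν ∉ closure T := fun hcl => hs
            ⟨hcl, fun hi => hsT (interior_subset hi)⟩
          filter_upwards [hline.continuousAt.eventually
            (isClosed_closure.isOpen_compl.mem_nhds this)] with r hr
          have : x + r • ν ∉ T := fun h' => hr (subset_closure h')
          simp [hsT, this]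
      filter_upwards [hrest, hT] with r hr hT
      simp only [hJ]
      rw [Finset.sum_congr rfl hr]
      congr 1
      simp only [Set.indicator_apply, hT]
  have hK : IsCompact ((fun s : ℝ => x + s • ν) ⁻¹' closure T) :=
    (isClosedEmbedding_add_smul hν x).isCompact_preimage h.isBounded.isCompact_closure
  have hbot : ∀ᶠ s in atBot, J s = 0 := by
    obtain ⟨m, hm⟩ := hK.bddBelow
    have hall : ∀ᶠ s in atBot, ∀ e ∈ F, s < crossing (n e) ν (c e) x := by
      rw [Filter.eventually_all_finset]
      exact fun e _ => eventually_lt_atBot _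
    filter_upwards [hall, eventually_lt_atBot m] with s hs hsm
    have hsT : x + s • ν ∉ T := fun hT => hsm.not_ge (hm (subset_closure hT))
    simp only [hJ]
    rw [Set.indicator_of_notMem hsT, zero_add]
    refine Finset.sum_eq_zero fun e he => ?_
    simp [jump_zero_of_lt (hs e he)]
  obtain ⟨s, hs⟩ := hbot.exists
  have h0 : J 0 = 0 := (hJc.apply_eq_of_preconnectedSpace 0 s).trans hs
  simp only [hJ, zero_smul, add_zero] at h0
  linarith

/-! ### The divergence theorem for compactly supported functions -/

theorem measurable_jump_crossing (n ν : E d) (c a : ℝ) :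
    Measurable (fun x => jump a (crossing n ν c x) 0) := by
  have hc := (continuous_crossing n ν c).measurable
  refine Measurable.ite ?_ measurable_const measurable_const
  refine (measurableSet_lt hc measurable_const).union ?_
  by_cases h : 0 < a
  · simp only [h, true_and]
    exact hc (measurableSet_singleton 0)
  · simp only [h, false_and]
    exact MeasurableSet.empty

/-- The integral over `[0, ∞)` of the derivative of a compactly supported function along a ray. -/
theorem integral_jump_mul_fderiv {f : Fld d} (hf : ContDiff ℝ 1 f) (hfc : HasCompactSupport f)
    {ν : E d} (hν : ν ≠ 0) (y : E d) (a : ℝ) :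
    ∫ t : ℝ, jump a (-t) 0 * fderiv ℝ f (y + t • ν) ν = - f y := by
  have hd : ∀ t : ℝ, HasDerivAt (fun t : ℝ => f (y + t • ν)) (fderiv ℝ f (y + t • ν) ν) t := by
    intro t
    have h1 : HasDerivAt (fun t : ℝ => y + t • ν) ν t := by
      simpa using ((hasDerivAt_id t).smul_const ν).const_add y
    exact ((hf.differentiable one_ne_zero) _).hasFDerivAt.comp_hasDerivAt t h1
  have hg : ContDiff ℝ 1 (fun t : ℝ => f (y + t • ν)) := hf.comp (by fun_prop)
  have hgc : HasCompactSupport (fun t : ℝ => f (y + t • ν)) :=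
    hfc.comp_isClosedEmbedding (isClosedEmbedding_add_smul hν y)
  have key := hgc.integral_Ioi_deriv_eq hg 0
  simp only [(hd _).deriv, zero_smul, add_zero] at key
  rw [← key, ← integral_indicator measurableSet_Ioi]
  refine integral_congr_ae ?_
  filter_upwards [Measure.ae_ne volume (0 : ℝ)] with t ht
  by_cases h0 : 0 < t
  · simp [jump, h0]
  · simp [jump, h0, ht]

open Classical in
/-- The contribution of one face. -/
theorem integral_cylinder_mul_fderiv {f : Fld d} (hf : ContDiff ℝ 1 f) (hfc : HasCompactSupport f)
    {n ν : E d} {c : ℝ} (hn : ‖n‖ = 1) (ha : inner ℝ n ν ≠ 0) {e : Set (E d)}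
    (he : IsCompact e) (hec : e ⊆ hyperplane n c) :
    Integrable (fun x => (if foot n ν c x ∈ e then jump (inner ℝ n ν) (crossing n ν c x) 0 else 0) *
      fderiv ℝ f x ν) ∧
    ∫ x, (if foot n ν c x ∈ e then jump (inner ℝ n ν) (crossing n ν c x) 0 else 0) *
      fderiv ℝ f x ν = - (|inner ℝ n ν| * ∫ x, f x ∂(surf e)) := by
  have := sFinite_surf_hyperplane hn c
  have hν : ν ≠ 0 := by rintro rfl; simp at ha
  set a : ℝ := inner ℝ n ν with haa
  set w : E d → ℝ := fun x => if foot n ν c x ∈ e then jump a (crossing n ν c x) 0 else 0 with hw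
  set h : E d → ℝ := fun x => w x * fderiv ℝ f x ν with hh
  have hwm : Measurable w :=
    Measurable.ite ((continuous_foot n ν c).measurable he.measurableSet)
      (measurable_jump_crossing n ν c a) measurable_const
  have hw1 : ∀ x, ‖w x‖ ≤ 1 := by
    intro x
    simp only [hw, jump]
    split_ifs <;> simp
  have hg : Integrable (fun x => fderiv ℝ f x ν) := by
    refine Continuous.integrable_of_hasCompactSupport ?_ ?_
    · exact (hf.continuous_fderiv one_ne_zero).clm_apply continuous_const
    · exact (hfc.fderiv ℝ).comp_left (g := fun L : E d →L[ℝ] ℝ => L ν) (by simp)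
  have hint : Integrable h := hg.bdd_mul hwm.aestronglyMeasurable (Eventually.of_forall hw1)
  refine ⟨hint, ?_⟩
  have hm : Measurable (fun p : E d × ℝ => p.1 + p.2 • ν) := by fun_prop
  have hvol := volume_eq_smul_map_prod hn c ha
  rw [← haa] at hvol
  have ha0 : ENNReal.ofReal |a| ≠ 0 := by simpa using ha
  have hint' : Integrable h (((surf (hyperplane n c)).prod volume).map
      (fun p : E d × ℝ => p.1 + p.2 • ν)) := by
    rw [hvol] at hint
    exact (integrable_smul_measure ha0 ENNReal.ofReal_ne_top).1 hint
  have hint2 : Integrable (fun p : E d × ℝ => h (p.1 + p.2 • ν))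
      ((surf (hyperplane n c)).prod volume) := hint'.comp_measurable hm
  have hfib : ∀ y ∈ hyperplane n c, ∫ t : ℝ, h (y + t • ν) = e.indicator (fun y => - f y) y := by
    intro y hy
    simp only [hh, hw, foot_add_smul ha, foot_of_mem hy, crossing_add_smul ha, crossing_of_mem hy,
      zero_sub]
    by_cases hye : y ∈ e
    · simp only [hye, if_true, Set.indicator_of_mem]
      exact integral_jump_mul_fderiv hf hfc hν y a
    · simp [hye]
  calc ∫ x, h x = |a| * ∫ x, h x ∂(((surf (hyperplane n c)).prod volume).map
      (fun p : E d × ℝ => p.1 + p.2 • ν)) := by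
        conv_lhs => rw [hvol]
        rw [integral_smul_measure, ENNReal.toReal_ofReal (abs_nonneg a), smul_eq_mul]
    _ = |a| * ∫ y, e.indicator (fun y => - f y) y ∂(surf (hyperplane n c)) := by
        rw [integral_map hm.aemeasurable hint'.aestronglyMeasurable, integral_prod _ hint2]
        congr 1
        refine integral_congr_ae ?_
        filter_upwards [ae_restrict_mem (isClosed_hyperplane n c).measurableSet] with y hy
        exact hfib y hy
    _ = - (|a| * ∫ x, f x ∂(surf e)) := by
        rw [integral_indicator he.measurableSet, Measure.restrict_restrict he.measurableSet,
          Set.inter_eq_left.2 hec, integral_neg, mul_neg]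

namespace FlatBoundary

variable {T : Set (E d)} {F : Finset (Set (E d))} {n : Set (E d) → E d} {c : Set (E d) → ℝ}

/-- Inserting `indicator_eq` splits the volume integral into half-cylinders over the faces. The sign
of the jump and the Jacobian combine to `sign a * |a| = a`. -/
theorem integral_fderiv_of_transversal (h : FlatBoundary T F n c) {f : Fld d}
    (hf : ContDiff ℝ 1 f) (hfc : HasCompactSupport f) {ν : E d} (hν : ν ≠ 0)
    (ha : ∀ e ∈ F, inner ℝ (n e) ν ≠ 0) :
    ∫ x in T, fderiv ℝ f x ν = ∑ e ∈ F, inner ℝ (n e) ν * ∫ x, f x ∂(surf e) := by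
  classical
  have hface := fun e (he : e ∈ F) => integral_cylinder_mul_fderiv hf hfc (h.norm_eq e he)
    (ha e he) (h.isCompact e he) (h.subset e he)
  rw [← integral_indicator h.isOpen.measurableSet]
  calc ∫ x, T.indicator (fun x => fderiv ℝ f x ν) x
      = ∫ x, ∑ e ∈ F, - (SignType.sign (inner ℝ (n e) ν) : ℝ) *
          ((if foot (n e) ν (c e) x ∈ e then
            jump (inner ℝ (n e) ν) (crossing (n e) ν (c e) x) 0 else 0) * fderiv ℝ f x ν) := by
        refine integral_congr_ae ?_
        filter_upwards [h.indicator_eq hν ha] with x hx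
        have : T.indicator (fun x => fderiv ℝ f x ν) x =
            T.indicator (fun _ => (1 : ℝ)) x * fderiv ℝ f x ν := by
          by_cases hxT : x ∈ T <;> simp [hxT]
        rw [this, hx, neg_mul, Finset.sum_mul, ← Finset.sum_neg_distrib]
        refine Finset.sum_congr rfl fun e _ => ?_
        split_ifs <;> ring
    _ = ∑ e ∈ F, inner ℝ (n e) ν * ∫ x, f x ∂(surf e) := by
        rw [integral_finsetSum F fun e he => (hface e he).1.const_mul _]
        refine Finset.sum_congr rfl fun e he => ?_
        rw [integral_const_mul, (hface e he).2]
        conv_rhs => rw [← sign_mul_abs (inner ℝ (n e) ν : ℝ)]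
        ring

/-- The divergence theorem for compactly supported functions. -/
theorem integral_fderiv_of_hasCompactSupport (h : FlatBoundary T F n c) {f : Fld d}
    (hf : ContDiff ℝ 1 f) (hfc : HasCompactSupport f) (ν : E d) :
    ∫ x in T, fderiv ℝ f x ν = ∑ e ∈ F, inner ℝ (n e) ν * ∫ x, f x ∂(surf e) := by
  classical
  have hint : ∀ ν : E d, Integrable (fun x => fderiv ℝ f x ν) (vol T) := by
    intro ν
    refine Integrable.integrableOn (Continuous.integrable_of_hasCompactSupport ?_ ?_)
    · exact (hf.continuous_fderiv one_ne_zero).clm_apply continuous_const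
    · exact (hfc.fderiv ℝ).comp_left (g := fun L : E d →L[ℝ] ℝ => L ν) (by simp)
  let L : E d →ₗ[ℝ] ℝ :=
    { toFun := fun ν => (∫ x in T, fderiv ℝ f x ν) -
        ∑ e ∈ F, inner ℝ (n e) ν * ∫ x, f x ∂(surf e)
      map_add' := by
        intro u v
        simp only [map_add, inner_add_right, add_mul, Finset.sum_add_distrib]
        rw [integral_add (hint u) (hint v)]
        ring
      map_smul' := by
        intro t u
        simp only [map_smul, inner_smul_right, smul_eq_mul, mul_assoc, ← Finset.mul_sum,
          RingHom.id_apply, integral_const_mul]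
        ring }
  suffices hL : L = 0 by
    have := LinearMap.congr_fun hL ν
    exact sub_eq_zero.1 this
  by_contra hL
  -- A real vector space is not a finite union of proper subspaces. If `L ≠ 0`, some `u` is
  -- transversal to every face and has `L u ≠ 0`, contradicting the transversal case.
  let S : Finset (Subspace ℝ (E d)) :=
    insert (LinearMap.ker L) (F.image fun e => LinearMap.ker (innerₗ (E d) (n e)))
  have hS : ⊤ ∉ S := by
    intro hmem
    rcases Finset.mem_insert.1 hmem with h1 | h1
    · exact hL (LinearMap.ker_eq_top.1 h1.symm)
    · obtain ⟨e, he, h2⟩ := Finset.mem_image.1 h1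
      have h3 : (innerₗ (E d) (n e)) (n e) = 0 := by
        rw [LinearMap.ker_eq_top.1 h2]; rfl
      have h4 : inner ℝ (n e) (n e) = (0 : ℝ) := h3
      have := h.norm_eq e he
      rw [inner_self_eq_zero.1 h4] at this
      simp at this
  obtain ⟨u, hu⟩ := (Set.ne_univ_iff_exists_notMem _).1 (Subspace.biUnion_ne_univ_of_top_notMem hS)
  simp only [Set.mem_iUnion, not_exists] at hu
  have huL : L u ≠ 0 := fun h0 => hu _ (Finset.mem_insert_self _ _) h0
  have hun : ∀ e ∈ F, inner ℝ (n e) u ≠ 0 := fun e he h0 =>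
    hu _ (Finset.mem_insert_of_mem (Finset.mem_image_of_mem _ he)) h0
  have hu0 : u ≠ 0 := by rintro rfl; simp at huL
  exact huL (sub_eq_zero.2 (h.integral_fderiv_of_transversal hf hfc hu0 hun))

end FlatBoundary

/-! ### The divergence theorem -/

/-- The half spaces are cones with vertex `x`, so agreement near `x` gives agreement everywhere
after shrinking `y` by a small `t > 0`. -/
theorem IsOutwardNormalAt.inner_neg_iff {T : Set (E d)} {x n n' : E d}
    (h : IsOutwardNormalAt T x n) (h' : IsOutwardNormalAt T x n') (y : E d) :
    inner ℝ n y < 0 ↔ inner ℝ n' y < 0 := by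
  have hc : Tendsto (fun t : ℝ => x + t • y) (𝓝[>] 0) (𝓝 x) := by
    have : Continuous (fun t : ℝ => x + t • y) := by fun_prop
    simpa using this.continuousWithinAt.tendsto (x := (0 : ℝ)) (s := Set.Ioi 0)
  obtain ⟨t, ⟨ht1, ht2⟩, ht⟩ := (((hc.eventually h.2).and (hc.eventually h'.2)).and
    self_mem_nhdsWithin).exists
  have ht : 0 < t := ht
  simp only [add_sub_cancel_left, inner_smul_right] at ht1 ht2
  have hm : ∀ a : ℝ, t * a < 0 ↔ a < 0 := fun a => by
    constructor
    · intro h; by_contra hge; exact absurd h (not_lt.2 (mul_nonneg ht.le (not_lt.1 hge)))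
    · exact mul_neg_of_pos_of_neg ht
  rw [← hm, ← ht1, ht2, hm]

theorem IsOutwardNormalAt.unique {T : Set (E d)} {x n n' : E d}
    (h : IsOutwardNormalAt T x n) (h' : IsOutwardNormalAt T x n') : n = n' := by
  by_contra hne
  have hlt : inner ℝ n n' < 1 := inner_lt_one_iff_real_of_norm_eq_one h.1 h'.1 |>.2 hne
  have h1 : inner ℝ n (n' - n) < 0 := by
    rw [inner_sub_right, real_inner_self_eq_norm_sq, h.1]
    linarith
  have h2 := (h.inner_neg_iff h' _).1 h1
  rw [inner_sub_right, real_inner_self_eq_norm_sq, h'.1, real_inner_comm] at h2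
  linarith

theorem IsOutwardNormalAt.outwardNormal_eq {T : Set (E d)} {x n : E d}
    (h : IsOutwardNormalAt T x n) : outwardNormal T x = n := by
  have hex : ∃ n, IsOutwardNormalAt T x n := ⟨n, h⟩
  rw [outwardNormal, dif_pos hex]
  exact hex.choose_spec.unique h

namespace FlatBoundary

variable {T : Set (E d)} {F : Finset (Set (E d))} {n : Set (E d) → E d} {c : Set (E d) → ℝ}

theorem isFiniteMeasure_surf (h : FlatBoundary T F n c) {e : Set (E d)} (he : e ∈ F) :
    IsFiniteMeasure (surf e) :=
  ⟨by simpa using surf_lt_top_of_isCompact (h.norm_eq e he) (h.isCompact e he) (h.subset e he)⟩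

/-- Overlaps are null, so boundary integrals split face by face; on each face the normal is a
constant. -/
theorem surf_frontier (h : FlatBoundary T F n c) : surf (frontier T) = ∑ e ∈ F, surf e := by
  have hU : frontier T = ⋃ e : F, (e : Set (E d)) := by
    rw [h.frontier_eq, Set.iUnion_subtype]
  rw [hU, surf, Measure.restrict_iUnion_ae, Measure.sum_fintype, Finset.sum_coe_sort F surf]
  · intro e e' hne
    have := h.overlap e e.2 e' e'.2 (fun heq => hne (Subtype.ext heq.symm))
    rw [Measure.restrict_apply (h.isCompact _ e'.2).measurableSet, Set.inter_comm] at this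
    exact this
  · exact fun e => (h.isCompact e e.2).measurableSet.nullMeasurableSet

theorem isFiniteMeasure_surf_frontier (h : FlatBoundary T F n c) :
    IsFiniteMeasure (surf (frontier T)) := by
  refine ⟨?_⟩
  rw [h.surf_frontier, Measure.finsetSum_apply]
  refine ENNReal.sum_lt_top.2 fun e he => ?_
  have := h.isFiniteMeasure_surf he
  exact measure_lt_top _ _

theorem outwardNormal_ae_eq (h : FlatBoundary T F n c) {e : Set (E d)} (he : e ∈ F) :
    ∀ᵐ x ∂(surf e), outwardNormal T x = n e := by
  filter_upwards [h.normal e he] with x hx using hx.outwardNormal_eq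

theorem ae_surf_frontier_iff (h : FlatBoundary T F n c) {p : E d → Prop} :
    (∀ᵐ x ∂(surf (frontier T)), p x) ↔ ∀ e ∈ F, ∀ᵐ x ∂(surf e), p x := by
  simp only [h.surf_frontier, ae_iff, Measure.finsetSum_apply, Finset.sum_eq_zero_iff]

theorem ae_isOutwardNormalAt (h : FlatBoundary T F n c) :
    ∀ᵐ x ∂(surf (frontier T)), IsOutwardNormalAt T x (outwardNormal T x) := by
  rw [h.ae_surf_frontier_iff]
  intro e he
  filter_upwards [h.normal e he] with x hx
  rwa [hx.outwardNormal_eq]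

theorem integral_surf_frontier (h : FlatBoundary T F n c) {f : Fld d}
    (hf : ∀ e ∈ F, Integrable f (surf e)) :
    ∫ x, f x ∂(surf (frontier T)) = ∑ e ∈ F, ∫ x, f x ∂(surf e) := by
  rw [h.surf_frontier, integral_finsetSum_measure hf]

theorem face_subset_frontier (h : FlatBoundary T F n c) {e : Set (E d)} (he : e ∈ F) :
    e ⊆ frontier T := by
  rw [h.frontier_eq]
  exact Set.subset_biUnion_of_mem (u := fun e => e) he

theorem integrable_surf_of_continuous (h : FlatBoundary T F n c) {f : Fld d} (hf : Continuous f)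
    {e : Set (E d)} (he : e ∈ F) : Integrable f (surf e) := by
  have := h.isFiniteMeasure_surf he
  obtain ⟨C, hC⟩ := (h.isCompact e he).exists_bound_of_continuousOn hf.continuousOn
  refine Integrable.of_bound hf.aestronglyMeasurable C ?_
  filter_upwards [ae_restrict_mem (h.isCompact e he).measurableSet] with x hx using hC x hx

theorem integral_mul_outwardNormal (h : FlatBoundary T F n c) {f : Fld d} (hf : Continuous f)
    (ν : E d) :
    ∫ x, f x * inner ℝ (outwardNormal T x) ν ∂(surf (frontier T)) =
      ∑ e ∈ F, inner ℝ (n e) ν * ∫ x, f x ∂(surf e) := by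
  have hae : ∀ e ∈ F, (fun x => f x * inner ℝ (outwardNormal T x) ν) =ᵐ[surf e]
      fun x => inner ℝ (n e) ν * f x := by
    intro e he
    filter_upwards [h.outwardNormal_ae_eq he] with x hx
    rw [hx, mul_comm]
  rw [h.integral_surf_frontier]
  · refine Finset.sum_congr rfl fun e he => ?_
    rw [integral_congr_ae (hae e he), integral_const_mul]
  · intro e he
    exact ((h.integrable_surf_of_continuous hf he).const_mul _).congr (hae e he).symm

/-- The divergence theorem on a domain with flat boundary. -/
theorem integral_fderiv (h : FlatBoundary T F n c) {f : Fld d} (hf : ContDiff ℝ 1 f) (ν : E d) :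
    ∫ x in T, fderiv ℝ f x ν = ∫ x, f x * inner ℝ (outwardNormal T x) ν ∂(surf (frontier T)) := by
  -- A cutoff equal to `1` near `closure T` reduces to compact support without changing either side.
  obtain ⟨R, hR0, hR⟩ := h.isBounded.closure.subset_ball_lt 0 0
  let χ : ContDiffBump (0 : E d) := ⟨R, R + 1, hR0, by linarith⟩
  have hχ1 : ∀ x ∈ closure T, χ =ᶠ[𝓝 x] 1 := fun x hx =>
    χ.eventuallyEq_one_of_mem_ball (hR hx)
  have hg : ContDiff ℝ 1 (fun x => χ x * f x) := χ.contDiff.mul hf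
  have hgc : HasCompactSupport (fun x => χ x * f x) := χ.hasCompactSupport.mul_right
  have h1 : ∫ x in T, fderiv ℝ f x ν = ∫ x in T, fderiv ℝ (fun x => χ x * f x) x ν := by
    refine setIntegral_congr_fun h.isOpen.measurableSet fun x hx => ?_
    have : (fun x => χ x * f x) =ᶠ[𝓝 x] f := by
      filter_upwards [hχ1 x (subset_closure hx)] with y hy
      simp [hy]
    simp only [this.fderiv_eq]
  rw [h1, h.integral_fderiv_of_hasCompactSupport hg hgc, h.integral_mul_outwardNormal hf.continuous]
  refine Finset.sum_congr rfl fun e he => ?_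
  congr 1
  refine setIntegral_congr_fun (h.isCompact e he).measurableSet fun x hx => ?_
  have := (hχ1 x (frontier_subset_closure (h.face_subset_frontier he hx))).self_of_nhds
  simp [this]

theorem integral_pd (h : FlatBoundary T F n c) {f : Fld d} (hf : ContDiff ℝ 1 f) (j : Fin d) :
    ∫ x in T, pd j f x = ∫ x, f x * outwardNormal T x j ∂(surf (frontier T)) := by
  have := h.integral_fderiv hf (EuclideanSpace.single j 1)
  simpa [pd, EuclideanSpace.inner_single_right] using this

end FlatBoundary

theorem contDiff_pd {f : Fld d} (hf : ContDiff ℝ ∞ f) (j : Fin d) : ContDiff ℝ ∞ (pd j f) :=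
  (hf.fderiv_right (m := ∞) (by simp)).clm_apply contDiff_const

theorem pd_mul {f g : Fld d} {x : E d} (hf : DifferentiableAt ℝ f x)
    (hg : DifferentiableAt ℝ g x) (j : Fin d) :
    pd j (fun y => f y * g y) x = pd j f x * g x + f x * pd j g x := by
  simp only [pd]
  rw [fderiv_fun_mul hf hg]
  simp
  ring

theorem integrable_vol_of_continuous {T : Set (E d)} (hT : Bornology.IsBounded T) {f : Fld d}
    (hf : Continuous f) : Integrable f (vol T) :=
  (hf.continuousOn.integrableOn_compact hT.isCompact_closure).mono_set subset_closure

/-- Integration by parts on a domain with flat boundary. -/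
theorem FlatBoundary.integral_pd_mul {T : Set (E d)} {F : Finset (Set (E d))}
    {n : Set (E d) → E d} {c : Set (E d) → ℝ} (h : FlatBoundary T F n c) {f q : Fld d}
    (hf : ContDiff ℝ ∞ f) (hq : ContDiff ℝ ∞ q) (j : Fin d) :
    ∫ x in T, pd j f x * q x = - (∫ x in T, f x * pd j q x) +
      ∫ x, f x * q x * outwardNormal T x j ∂(surf (frontier T)) := by
  have h1 : (1 : WithTop ℕ∞) ≤ ∞ := by norm_cast
  have := h.integral_pd ((hf.mul hq).of_le h1) j
  rw [← this, eq_neg_add_iff_add_eq, ← integral_add]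
  · refine integral_congr_ae (Eventually.of_forall fun x => ?_)
    rw [pd_mul (hf.differentiable (by simp) x) (hq.differentiable (by simp) x)]
    ring
  · exact integrable_vol_of_continuous h.isBounded (hf.continuous.mul (contDiff_pd hq j).continuous)
  · exact integrable_vol_of_continuous h.isBounded ((contDiff_pd hf j).continuous.mul hq.continuous)

open Classical in
theorem PolyhedralMesh.exists_flatBoundary {Ω : Set (E d)} (M : PolyhedralMesh Ω) {T : Set (E d)}
    (hT : T ∈ M.elems) :
    ∃ n c, FlatBoundary T (M.faces.filter (· ⊆ frontier T)) n c := by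
  have hflat : ∀ e, ∃ (n : E d) (c : ℝ), e ∈ M.faces.filter (· ⊆ frontier T) →
      ‖n‖ = 1 ∧ e ⊆ hyperplane n c ∧ ∀ᵐ x ∂(surf e), IsOutwardNormalAt T x n := by
    intro e
    by_cases he : e ∈ M.faces.filter (· ⊆ frontier T)
    · obtain ⟨heF, heT⟩ := Finset.mem_filter.1 he
      obtain ⟨-, -, n, hn, ⟨c, hc⟩, hae⟩ := M.face_flat T hT e heF heT
      exact ⟨n, c, fun _ => ⟨hn, hc, hae⟩⟩
    · exact ⟨0, 0, fun h => absurd h he⟩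
  choose n c hnc using hflat
  refine ⟨n, c, (M.elem_polyhedral T hT).isOpen, (M.elem_polyhedral T hT).isBounded, ?_,
    fun e he => (hnc e he).1, fun e he => (hnc e he).2.1, fun e he => (hnc e he).2.2, ?_, ?_⟩
  · intro e he
    obtain ⟨heF, heT⟩ := Finset.mem_filter.1 he
    exact (M.face_flat T hT e heF heT).1
  · intro e he e' he' hne
    exact M.face_overlap e (Finset.mem_filter.1 he).1 e' (Finset.mem_filter.1 he').1 hne.symm
  · conv_lhs => rw [M.frontier_eq T hT]
    simp

/-! ### The trace inequality -/

/-- Glues the local Lipschitz charts: transversal directions in the trace inequality, inward shifts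
in the density theorem. -/
theorem exists_smooth_partition {K : Set (E d)} (hK : IsCompact K) {r : E d → ℝ}
    (hr : ∀ x ∈ K, 0 < r x) :
    ∃ (t : Finset (E d)) (χ : E d → Fld d), (∀ x ∈ t, x ∈ K) ∧
      (∀ x ∈ t, ContDiff ℝ ∞ (χ x) ∧ (∀ y, 0 ≤ χ x y) ∧ tsupport (χ x) ⊆ Metric.ball x (r x)) ∧
      ∀ y ∈ K, ∑ x ∈ t, χ x y = 1 := by
  classical
  obtain ⟨t, htK, hcov⟩ := hK.elim_nhds_subcover (fun x => Metric.ball x (r x))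
    fun x hx => Metric.ball_mem_nhds x (hr x hx)
  obtain ⟨f, hf⟩ := SmoothPartitionOfUnity.exists_isSubordinate (modelWithCornersSelf ℝ (E d))
    hK.isClosed (fun x : t => Metric.ball (x : E d) (r x)) (fun _ => Metric.isOpen_ball)
    (by simpa [Set.iUnion_subtype] using hcov)
  refine ⟨t, fun x => if hx : x ∈ t then f ⟨x, hx⟩ else 0, htK, fun x hx => ?_, fun y hy => ?_⟩
  · simp only [hx, dif_pos]
    exact ⟨(f ⟨x, hx⟩).contMDiff.contDiff, fun y => f.nonneg _ y, hf ⟨x, hx⟩⟩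
  · have := f.sum_eq_one hy
    rw [finsum_eq_sum_of_fintype] at this
    rw [← this, ← Finset.sum_coe_sort]
    refine Finset.sum_congr rfl fun x _ => ?_
    simp

theorem inner_le_of_mem_closure {T : Set (E d)} {x₀ x ν : E d} {r : ℝ} {ζ : E d → ℝ}
    (hζ : Continuous ζ) (hT : ∀ y ∈ Metric.ball x₀ r, y ∈ T ↔ inner ℝ ν y < ζ y)
    (hx : x ∈ Metric.ball x₀ r) (hxT : x ∈ closure T) : inner ℝ ν x ≤ ζ x := by
  have h1 : x ∈ closure (Metric.ball x₀ r ∩ T) := Metric.isOpen_ball.inter_closure ⟨hx, hxT⟩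
  have h2 : IsClosed {y : E d | inner ℝ ν y ≤ ζ y} := isClosed_le (by fun_prop) hζ
  exact closure_minimal (fun y hy => ((hT y hy.1).1 hy.2).le) h2 h1

/-- The outward normals of a Lipschitz domain are locally uniformly transversal. -/
theorem HasLipschitzBoundary.exists_transversal {T : Set (E d)} (hT : HasLipschitzBoundary T)
    {x₀ : E d} (hx₀ : x₀ ∈ frontier T) :
    ∃ (ν : E d) (r δ : ℝ), 0 < r ∧ 0 < δ ∧ ∀ x ∈ Metric.ball x₀ r, x ∈ frontier T →
      ∀ n, IsOutwardNormalAt T x n → δ ≤ inner ℝ n ν := by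
  obtain ⟨ν, hν, r, hr, K, ζ, hζ, hinv, hloc⟩ := hT x₀ hx₀
  have hpos : (0 : ℝ) < 2 + K := by positivity
  -- Move from `x` along `l • n - ν` with `l = (2 + K)⁻¹`. Relative to the graph, the height changes
  -- at rate at most `-1 + l + K * l = -l < 0`, so the point enters `T`. Since `n` is the normal,
  -- `⟪n, l • n - ν⟫ < 0`, that is `l < ⟪n, ν⟫`.
  refine ⟨ν, r, (2 + K)⁻¹, hr, by positivity, fun x hx hxT n hn => ?_⟩
  set l : ℝ := (2 + K)⁻¹ with hl
  have hl0 : 0 < l := by positivity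
  have hlK : l * (2 + K) = 1 := inv_mul_cancel₀ hpos.ne'
  have hx1 := inner_le_of_mem_closure hζ.continuous hloc hx (frontier_subset_closure hxT)
  have hc : Tendsto (fun t : ℝ => x + t • (l • n - ν)) (𝓝[>] 0) (𝓝 x) := by
    have : Continuous (fun t : ℝ => x + t • (l • n - ν)) := by fun_prop
    simpa using this.continuousWithinAt.tendsto (x := (0 : ℝ)) (s := Set.Ioi 0)
  obtain ⟨t, ⟨ht1, ht2⟩, ht⟩ := (((hc.eventually hn.2).and
    (hc.eventually (Metric.isOpen_ball.mem_nhds hx))).and self_mem_nhdsWithin).exists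
  have ht : 0 < t := ht
  have hζy : ζ (x + t • (l • n - ν)) = ζ (x + (t * l) • n) := by
    rw [← hinv (x + t • (l • n - ν)) t]
    congr 1
    module
  have hLip : ζ x - K * (t * l) ≤ ζ (x + (t * l) • n) := by
    have h1 := hζ.dist_le_mul x (x + (t * l) • n)
    have h2 : dist x (x + (t * l) • n) = t * l := by
      rw [dist_self_add_right, norm_smul, hn.1, mul_one, Real.norm_of_nonneg (by positivity)]
    rw [h2, Real.dist_eq] at h1
    linarith [(abs_le.1 h1).2]
  have hnν : inner ℝ ν n ≤ (1 : ℝ) := by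
    have := real_inner_le_norm ν n
    rwa [hν, hn.1, one_mul] at this
  have hyT : x + t • (l • n - ν) ∈ T := by
    rw [hloc _ ht2, hζy]
    have hin : inner ℝ ν (x + t • (l • n - ν)) = inner ℝ ν x + t * (l * inner ℝ ν n - 1) := by
      rw [inner_add_right, inner_smul_right, inner_sub_right, inner_smul_right,
        real_inner_self_eq_norm_sq, hν]
      ring
    rw [hin]
    have h3 : t * (l * inner ℝ ν n - 1) ≤ t * (l * 1 - 1) := by gcongr
    have h4 : l * K = 1 - 2 * l := by linarith
    have h5 : K * (t * l) = t * (1 - 2 * l) := by rw [← h4]; ring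
    nlinarith [mul_pos ht hl0]
  have hneg := ht1.1 hyT
  rw [add_sub_cancel_left, inner_smul_right, inner_sub_right, inner_smul_right,
    real_inner_self_eq_norm_sq, hn.1] at hneg
  by_contra hlt
  have : 0 < t * (l * 1 ^ 2 - inner ℝ n ν) := mul_pos ht (by linarith [not_le.1 hlt])
  linarith

theorem fderiv_apply_eq_sum_pd (f : Fld d) (x ν : E d) :
    fderiv ℝ f x ν = ∑ j, ν j * pd j f x := by
  have hν : ν = ∑ j, ν j • EuclideanSpace.single j (1 : ℝ) := by
    simpa using ((EuclideanSpace.basisFun (Fin d) ℝ).sum_repr ν).symm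
  conv_lhs => rw [hν]
  simp [pd]

/-- The integrand of the square of the `H¹` norm. -/
def sobolevSq (f : Fld d) (x : E d) : ℝ := f x ^ 2 + ∑ j, pd j f x ^ 2

theorem continuous_sobolevSq {f : Fld d} (hf : ContDiff ℝ ∞ f) : Continuous (sobolevSq f) := by
  refine (hf.continuous.pow 2).add (continuous_finsetSum _ fun j _ => ?_)
  exact (contDiff_pd hf j).continuous.pow 2

namespace FlatBoundary

variable {T : Set (E d)} {F : Finset (Set (E d))} {n : Set (E d) → E d} {c : Set (E d) → ℝ}

theorem integrable_mul_outwardNormal (h : FlatBoundary T F n c) {f : Fld d} (hf : Continuous f)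
    (ν : E d) :
    Integrable (fun x => f x * inner ℝ (outwardNormal T x) ν) (surf (frontier T)) := by
  rw [h.surf_frontier, integrable_finsetSum_measure]
  intro e he
  refine ((h.integrable_surf_of_continuous hf he).const_mul (inner ℝ (n e) ν)).congr ?_
  filter_upwards [h.outwardNormal_ae_eq he] with x hx
  rw [hx, mul_comm]

theorem integrable_surf_frontier_of_continuous (h : FlatBoundary T F n c) {f : Fld d}
    (hf : Continuous f) : Integrable f (surf (frontier T)) := by
  rw [h.surf_frontier, integrable_finsetSum_measure]
  exact fun e he => h.integrable_surf_of_continuous hf he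

/-- By the divergence theorem the left side is `∫_T ∂_ν(φ² χ) = ∫_T (2 φ χ ∂_ν φ + φ² ∂_ν χ)`, and
`χ`, `∂_ν χ` are bounded. -/
theorem exists_integral_sq_mul_normal_le (h : FlatBoundary T F n c) {χ : Fld d}
    (hχ : ContDiff ℝ ∞ χ) (hχc : HasCompactSupport χ) (ν : E d) :
    ∃ B : ℝ, 0 ≤ B ∧ ∀ φ : Fld d, ContDiff ℝ ∞ φ →
      ∫ x, φ x ^ 2 * χ x * inner ℝ (outwardNormal T x) ν ∂(surf (frontier T)) ≤
        B * ∫ x in T, sobolevSq φ x := by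
  obtain ⟨B₁, hB₁⟩ := hχc.exists_bound_of_continuous hχ.continuous
  have hχ' : Continuous (fun x => fderiv ℝ χ x ν) :=
    (hχ.continuous_fderiv (by simp)).clm_apply continuous_const
  obtain ⟨B₂, hB₂⟩ := ((hχc.fderiv ℝ).comp_left (g := fun L : E d →L[ℝ] ℝ => L ν)
    (by simp)).exists_bound_of_continuous hχ'
  have hB₁0 : 0 ≤ B₁ := (norm_nonneg _).trans (hB₁ 0)
  have hB₂0 : 0 ≤ B₂ := (norm_nonneg _).trans (hB₂ 0)
  refine ⟨B₁ * (∑ j, |ν j|) * 2 + B₂, by positivity, fun φ hφ => ?_⟩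
  have hg : ContDiff ℝ ∞ (fun x => φ x ^ 2 * χ x) := (hφ.pow 2).mul hχ
  rw [← h.integral_fderiv (hg.of_le (by norm_cast)) ν, ← integral_const_mul]
  refine integral_mono ?_ ?_ fun x => ?_
  · exact integrable_vol_of_continuous h.isBounded
      ((hg.continuous_fderiv (by simp)).clm_apply continuous_const)
  · exact integrable_vol_of_continuous h.isBounded
      (continuous_const.mul (continuous_sobolevSq hφ))
  · have hdφ : DifferentiableAt ℝ φ x := hφ.differentiable (by simp) x
    have hdχ : DifferentiableAt ℝ χ x := hχ.differentiable (by simp) x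
    have hder : fderiv ℝ (fun x => φ x ^ 2 * χ x) x ν =
        2 * φ x * χ x * fderiv ℝ φ x ν + φ x ^ 2 * fderiv ℝ χ x ν := by
      rw [fderiv_fun_mul (hdφ.fun_pow 2) hdχ, fderiv_fun_pow 2 hdφ]
      simp
      ring
    simp only [hder]
    have hS : φ x ^ 2 ≤ sobolevSq φ x :=
      le_add_of_nonneg_right (Finset.sum_nonneg fun j _ => sq_nonneg _)
    have hSj : ∀ j, 2 * |φ x| * |pd j φ x| ≤ 2 * sobolevSq φ x := by
      intro j
      have h1 : pd j φ x ^ 2 ≤ sobolevSq φ x :=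
        (Finset.single_le_sum (f := fun j => pd j φ x ^ 2) (fun j _ => sq_nonneg _)
          (Finset.mem_univ j)).trans (le_add_of_nonneg_left (sq_nonneg _))
      have h2 := two_mul_le_add_sq |φ x| |pd j φ x|
      rw [sq_abs, sq_abs] at h2
      linarith
    have h1 : 2 * φ x * χ x * fderiv ℝ φ x ν ≤ B₁ * (∑ j, |ν j|) * 2 * sobolevSq φ x := by
      refine (le_abs_self _).trans ?_
      have h3 : |fderiv ℝ φ x ν| ≤ ∑ j, |ν j| * |pd j φ x| := by
        rw [fderiv_apply_eq_sum_pd]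
        refine (Finset.abs_sum_le_sum_abs _ _).trans_eq ?_
        simp [abs_mul]
      have h4 : |χ x| ≤ B₁ := hB₁ x
      calc |2 * φ x * χ x * fderiv ℝ φ x ν| = |χ x| * (2 * |φ x| * |fderiv ℝ φ x ν|) := by
            rw [abs_mul, abs_mul, abs_mul, abs_two]; ring
        _ ≤ B₁ * (2 * |φ x| * ∑ j, |ν j| * |pd j φ x|) := by gcongr
        _ = B₁ * ∑ j, |ν j| * (2 * |φ x| * |pd j φ x|) := by
            rw [Finset.mul_sum]
            congr 1
            exact Finset.sum_congr rfl fun j _ => by ring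
        _ ≤ B₁ * ∑ j, |ν j| * (2 * sobolevSq φ x) := by
            refine mul_le_mul_of_nonneg_left (Finset.sum_le_sum fun j _ => ?_) hB₁0
            exact mul_le_mul_of_nonneg_left (hSj j) (abs_nonneg _)
        _ = B₁ * (∑ j, |ν j|) * 2 * sobolevSq φ x := by
            rw [← Finset.sum_mul]; ring
    have h2 : φ x ^ 2 * fderiv ℝ χ x ν ≤ B₂ * sobolevSq φ x := by
      have h3 : fderiv ℝ χ x ν ≤ B₂ := (le_abs_self _).trans (hB₂ x)
      calc φ x ^ 2 * fderiv ℝ χ x ν ≤ φ x ^ 2 * B₂ := by gcongr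
        _ ≤ sobolevSq φ x * B₂ := by gcongr
        _ = _ := mul_comm _ _
    linarith

/-- The trace inequality. -/
theorem exists_trace_inequality (h : FlatBoundary T F n c) (hL : HasLipschitzBoundary T) :
    ∃ C : ℝ, 0 ≤ C ∧ ∀ φ : Fld d, ContDiff ℝ ∞ φ →
      ∫ x, φ x ^ 2 ∂(surf (frontier T)) ≤ C * ∫ x in T, sobolevSq φ x := by
  choose! ν r δ hr hδ hν using fun x (hx : x ∈ frontier T) => hL.exists_transversal hx
  have hK : IsCompact (frontier T) :=
    h.isBounded.isCompact_closure.of_isClosed_subset isClosed_frontier frontier_subset_closure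
  obtain ⟨t, χ, htK, hχ, hsum⟩ := exists_smooth_partition hK hr
  have hχc : ∀ x ∈ t, HasCompactSupport (χ x) := fun x hx =>
    (isCompact_closedBall x (r x)).of_isClosed_subset (isClosed_tsupport _)
      ((hχ x hx).2.2.trans Metric.ball_subset_closedBall)
  -- Scaling by `(δ x)⁻¹` makes the normal component of the direction at least `1` almost everywhere
  -- on the boundary within the support of `χ x`.
  choose! B hB0 hB using fun x (hx : x ∈ t) =>
    h.exists_integral_sq_mul_normal_le (hχ x hx).1 (hχc x hx) ((δ x)⁻¹ • ν x)
  refine ⟨∑ x ∈ t, B x, Finset.sum_nonneg hB0, fun φ hφ => ?_⟩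
  calc ∫ y, φ y ^ 2 ∂(surf (frontier T))
      ≤ ∫ y, ∑ x ∈ t, φ y ^ 2 * χ x y * inner ℝ (outwardNormal T y) ((δ x)⁻¹ • ν x)
          ∂(surf (frontier T)) := by
        refine integral_mono_ae ?_ ?_ ?_
        · exact h.integrable_surf_frontier_of_continuous (hφ.continuous.pow 2)
        · exact integrable_finsetSum _ fun x hx =>
            h.integrable_mul_outwardNormal ((hφ.continuous.pow 2).mul (hχ x hx).1.continuous) _
        · filter_upwards [h.ae_isOutwardNormalAt, ae_restrict_mem isClosed_frontier.measurableSet]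
            with y hy hyT
          calc φ y ^ 2 = ∑ x ∈ t, φ y ^ 2 * χ x y * 1 := by
                rw [← Finset.sum_mul, ← Finset.mul_sum, hsum y hyT]; ring
            _ ≤ _ := by
                refine Finset.sum_le_sum fun x hx => ?_
                by_cases hxy : y ∈ tsupport (χ x)
                · have h1 := hν x (htK x hx) y ((hχ x hx).2.2 hxy) hyT _ hy
                  have h2 : 1 ≤ inner ℝ (outwardNormal T y) ((δ x)⁻¹ • ν x) := by
                    rw [inner_smul_right, ← div_eq_inv_mul, le_div_iff₀ (hδ x (htK x hx))]
                    linarith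
                  have h3 := (hχ x hx).2.1 y
                  gcongr
                · simp [image_eq_zero_of_notMem_tsupport hxy]
    _ = ∑ x ∈ t, ∫ y, φ y ^ 2 * χ x y * inner ℝ (outwardNormal T y) ((δ x)⁻¹ • ν x)
          ∂(surf (frontier T)) := by
        rw [integral_finsetSum]
        exact fun x hx =>
          h.integrable_mul_outwardNormal ((hφ.continuous.pow 2).mul (hχ x hx).1.continuous) _
    _ ≤ ∑ x ∈ t, B x * ∫ x in T, sobolevSq φ x := Finset.sum_le_sum fun x hx => hB x hx φ hφ
    _ = _ := by rw [← Finset.sum_mul]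

end FlatBoundary

/-! ### Mollification -/

/-- A smooth compactly supported probability density. -/
structure IsMollifier (ρ : Fld d) : Prop where
  contDiff : ContDiff ℝ ∞ ρ
  hasCompactSupport : HasCompactSupport ρ
  nonneg : ∀ x, 0 ≤ ρ x
  integral_eq_one : ∫ x, ρ x = 1

/-- Convolution with `ρ`. -/
def mollify (ρ u : Fld d) : Fld d := fun x => ∫ z, ρ (x - z) * u z

theorem mollify_eq_convolution (ρ u : Fld d) :
    mollify ρ u = convolution ρ u (ContinuousLinearMap.lsmul ℝ ℝ) volume := by
  ext x
  rw [convolution_lsmul_swap]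
  rfl

theorem integrable_mollify {ρ u : Fld d} (hρ : Continuous ρ) (hρc : HasCompactSupport ρ)
    (hu : LocallyIntegrable u) (x : E d) : Integrable (fun z => ρ (x - z) * u z) := by
  have := (hρc.convolutionExists_left (ContinuousLinearMap.lsmul ℝ ℝ) hρ hu x).integrable_swap
  simpa using this

theorem contDiff_mollify {ρ u : Fld d} (hρ : ContDiff ℝ ∞ ρ) (hρc : HasCompactSupport ρ)
    (hu : LocallyIntegrable u) : ContDiff ℝ ∞ (mollify ρ u) := by
  rw [mollify_eq_convolution]
  exact hρc.contDiff_convolution_left (n := ⊤) (ContinuousLinearMap.lsmul ℝ ℝ) hρ hu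

theorem pd_mollify {ρ u : Fld d} (hρ : ContDiff ℝ ∞ ρ) (hρc : HasCompactSupport ρ)
    (hu : LocallyIntegrable u) (j : Fin d) (x : E d) :
    pd j (mollify ρ u) x = ∫ z, pd j ρ (x - z) * u z := by
  have h := hρc.hasFDerivAt_convolution_left (ContinuousLinearMap.lsmul ℝ ℝ)
    (hρ.of_le (by norm_cast)) hu x
  have hex : ConvolutionExistsAt (fderiv ℝ ρ) u x
      ((ContinuousLinearMap.lsmul ℝ ℝ : ℝ →L[ℝ] ℝ →L[ℝ] ℝ).precompL (E d)) volume :=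
    (hρc.fderiv ℝ).convolutionExists_left _ (hρ.continuous_fderiv (by simp)) hu x
  rw [pd, mollify_eq_convolution, h.fderiv, convolution_eq_swap,
    ContinuousLinearMap.integral_apply hex.integrable_swap]
  rfl

theorem hasCompactSupport_pd {f : Fld d} (hf : HasCompactSupport f) (j : Fin d) :
    HasCompactSupport (pd j f) :=
  (hf.fderiv ℝ).comp_left (g := fun L : E d →L[ℝ] ℝ => L (EuclideanSpace.single j 1)) (by simp)

theorem lintegral_enorm_sq_eq {α : Type*} {_ : MeasurableSpace α} (f : α → ℝ) (μ : Measure α) :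
    eLpNorm f 2 μ ^ 2 = ∫⁻ x, ‖f x‖ₑ ^ 2 ∂μ := by
  have := eLpNorm_nnreal_pow_eq_lintegral (f := f) (μ := μ) (p := 2) (by norm_num)
  simpa using this

theorem lintegral_sq_le_of_isProbabilityMeasure {α : Type*} {_ : MeasurableSpace α} {f : α → ℝ}
    {μ : Measure α} [IsProbabilityMeasure μ] (hf : AEStronglyMeasurable f μ) :
    (∫⁻ x, ‖f x‖ₑ ∂μ) ^ 2 ≤ ∫⁻ x, ‖f x‖ₑ ^ 2 ∂μ := by
  rw [← lintegral_enorm_sq_eq, ← eLpNorm_one_eq_lintegral_enorm]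
  gcongr
  exact eLpNorm_le_eLpNorm_of_exponent_le (by norm_num) hf

namespace IsMollifier

variable {ρ : Fld d}

theorem lintegral_eq_one (h : IsMollifier ρ) : ∫⁻ x, ENNReal.ofReal (ρ x) = 1 := by
  rw [← ofReal_integral_eq_lintegral_ofReal, h.integral_eq_one, ENNReal.ofReal_one]
  · exact h.contDiff.continuous.integrable_of_hasCompactSupport h.hasCompactSupport
  · exact Eventually.of_forall h.nonneg

/-- Jensen's inequality for the probability measure `ρ(x - z) dz` bounds the square pointwise;
Tonelli then integrates out `x`. -/
theorem eLpNorm_mollify_le (h : IsMollifier ρ) {u : Fld d} (hu : AEStronglyMeasurable u) :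
    eLpNorm (mollify ρ u) 2 volume ≤ eLpNorm u 2 volume := by
  have hρm : Measurable fun x => ENNReal.ofReal (ρ x) :=
    h.contDiff.continuous.measurable.ennreal_ofReal
  have hpt : ∀ x, ‖mollify ρ u x‖ₑ ^ 2 ≤ ∫⁻ z, ENNReal.ofReal (ρ (x - z)) * ‖u z‖ₑ ^ 2 := by
    intro x
    have hρx : Measurable fun z => ENNReal.ofReal (ρ (x - z)) :=
      hρm.comp (measurable_const.sub measurable_id)
    set p : Measure (E d) := volume.withDensity fun z => ENNReal.ofReal (ρ (x - z)) with hp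
    have : IsProbabilityMeasure p := by
      refine ⟨?_⟩
      rw [hp, withDensity_apply _ MeasurableSet.univ, setLIntegral_univ,
        lintegral_sub_left_eq_self (fun z => ENNReal.ofReal (ρ z)) x, h.lintegral_eq_one]
    have hup : AEStronglyMeasurable u p := hu.mono_ac (withDensity_absolutelyContinuous _ _)
    have h1 : ‖mollify ρ u x‖ₑ ≤ ∫⁻ z, ‖u z‖ₑ ∂p := by
      refine (enorm_integral_le_lintegral_enorm _).trans_eq ?_
      rw [hp, lintegral_withDensity_eq_lintegral_mul₀ hρx.aemeasurable hu.enorm]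
      refine lintegral_congr fun z => ?_
      rw [enorm_mul, Real.enorm_of_nonneg (h.nonneg _)]
      rfl
    calc ‖mollify ρ u x‖ₑ ^ 2 ≤ (∫⁻ z, ‖u z‖ₑ ∂p) ^ 2 := by gcongr
      _ ≤ ∫⁻ z, ‖u z‖ₑ ^ 2 ∂p := lintegral_sq_le_of_isProbabilityMeasure hup
      _ = _ := by
        rw [hp, lintegral_withDensity_eq_lintegral_mul₀ hρx.aemeasurable (hu.enorm.pow_const 2)]
        rfl
  have hsq : eLpNorm (mollify ρ u) 2 volume ^ 2 ≤ eLpNorm u 2 volume ^ 2 := by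
    rw [lintegral_enorm_sq_eq, lintegral_enorm_sq_eq]
    calc ∫⁻ x, ‖mollify ρ u x‖ₑ ^ 2
        ≤ ∫⁻ x, ∫⁻ z, ENNReal.ofReal (ρ (x - z)) * ‖u z‖ₑ ^ 2 := lintegral_mono hpt
      _ = ∫⁻ z, ∫⁻ x, ENNReal.ofReal (ρ (x - z)) * ‖u z‖ₑ ^ 2 := by
          rw [lintegral_lintegral_swap]
          refine AEMeasurable.mul ?_ ((hu.enorm.pow_const 2).comp_snd)
          exact (hρm.comp (measurable_fst.sub measurable_snd)).aemeasurable
      _ = ∫⁻ z, ‖u z‖ₑ ^ 2 := by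
          refine lintegral_congr fun z => ?_
          have hz : Measurable fun x => ENNReal.ofReal (ρ (x - z)) :=
            hρm.comp (measurable_id.sub measurable_const)
          rw [lintegral_mul_const _ hz,
            lintegral_sub_right_eq_self (fun x => ENNReal.ofReal (ρ x)) z, h.lintegral_eq_one,
            one_mul]
  exact (ENNReal.pow_le_pow_left_iff two_ne_zero).1 hsq

theorem dist_mollify_le (h : IsMollifier ρ) {r η : ℝ} (hη : 0 ≤ η)
    (hr : Function.support ρ ⊆ Metric.ball 0 r) {g : Fld d} (hg : AEStronglyMeasurable g) {x : E d}
    (hx : ∀ y ∈ Metric.ball x r, dist (g y) (g x) ≤ η) : dist (mollify ρ g x) (g x) ≤ η := by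
  rw [mollify_eq_convolution]
  exact dist_convolution_le hη hr h.nonneg h.integral_eq_one hg hx

end IsMollifier

theorem support_mollify_subset {ρ : Fld d} {r : ℝ} (hr : Function.support ρ ⊆ Metric.ball 0 r)
    (g : Fld d) : Function.support (mollify ρ g) ⊆ Metric.thickening r (tsupport g) := by
  intro x hx
  by_contra hnot
  refine hx ?_
  rw [mollify]
  refine integral_eq_zero_of_ae (Eventually.of_forall fun z => ?_)
  by_cases hz : z ∈ tsupport g
  · have : ρ (x - z) = 0 := by
      by_contra hρ
      have := hr hρ
      rw [mem_ball_zero_iff, ← dist_eq_norm] at this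
      exact hnot (Metric.mem_thickening_iff.2 ⟨z, hz, this⟩)
    simp [this]
  · simp [image_eq_zero_of_notMem_tsupport hz]

/-- Mollification converges in `L²`. -/
theorem tendstoL2_mollify {ρ : ℕ → Fld d} (hρ : ∀ m, IsMollifier (ρ m)) {r : ℕ → ℝ}
    (hρr : ∀ m, Function.support (ρ m) ⊆ Metric.ball 0 (r m)) (hr : Tendsto r atTop (𝓝 0))
    {u : Fld d} (hu : MemLp u 2 volume) :
    TendstoL2 volume (fun m => mollify (ρ m) u) u := by
  rw [TendstoL2, ENNReal.tendsto_nhds_zero]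
  intro ε hε
  by_cases hεt : ε = ⊤
  · simp [hεt]
  set η : ℝ := ε.toReal / 3 with hη
  have hη0 : 0 < η := by
    have := ENNReal.toReal_pos hε.ne' hεt
    positivity
  have hηε : ENNReal.ofReal η + ENNReal.ofReal η + ENNReal.ofReal η = ε := by
    rw [← ENNReal.ofReal_add hη0.le hη0.le, ← ENNReal.ofReal_add (by positivity) hη0.le, hη]
    rw [show ε.toReal / 3 + ε.toReal / 3 + ε.toReal / 3 = ε.toReal by ring,
      ENNReal.ofReal_toReal hεt]
  obtain ⟨g, hgc, hg, hgu⟩ := hu.exist_eLpNorm_sub_le (by norm_num) (by norm_num) hη0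
  have hgcont := hg.continuous
  have hg2 : MemLp g 2 volume := hgcont.memLp_of_hasCompactSupport hgc
  have hloc : LocallyIntegrable u := hu.locallyIntegrable (by norm_num)
  -- Contains the supports of `g` and of its mollifications once `r m < 1`, so a uniform bound `κ`
  -- costs at most `κ * V` in `L²`. Dividing by `V + 1` below keeps this under `η` even if `V = 0`.
  set K : Set (E d) := Metric.cthickening 1 (tsupport g) with hK
  have hKc : IsCompact K := hgc.isCompact.cthickening
  have hKm : volume K ≠ ⊤ := hKc.measure_lt_top.ne
  set V : ℝ := (volume K).toReal ^ (1 / 2 : ℝ) with hV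
  have hV0 : 0 ≤ V := by positivity
  set κ : ℝ := η / (V + 1) with hκ
  have hκ0 : 0 < κ := by positivity
  have huc : UniformContinuous g := hgc.uniformContinuous_of_continuous hgcont
  obtain ⟨δ, hδ0, hδ⟩ := Metric.uniformContinuous_iff.1 huc κ hκ0
  filter_upwards [hr.eventually (gt_mem_nhds hδ0), hr.eventually (gt_mem_nhds one_pos)]
    with m hm1 hm2
  have hsplit : (fun x => mollify (ρ m) u x - u x) =
      (mollify (ρ m) (u - g) + (mollify (ρ m) g - g)) + (g - u) := by
    ext x
    have : mollify (ρ m) (u - g) x = mollify (ρ m) u x - mollify (ρ m) g x := by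
      simp only [mollify, Pi.sub_apply, mul_sub]
      exact integral_sub
        (integrable_mollify (hρ m).contDiff.continuous (hρ m).hasCompactSupport hloc x)
        (integrable_mollify (hρ m).contDiff.continuous (hρ m).hasCompactSupport
          hgcont.locallyIntegrable x)
    simp only [Pi.add_apply, Pi.sub_apply, this]
    ring
  have hmoll : ∀ w : Fld d, LocallyIntegrable w → AEStronglyMeasurable (mollify (ρ m) w) volume :=
    fun w hw =>
      (contDiff_mollify (hρ m).contDiff (hρ m).hasCompactSupport hw).continuous.aestronglyMeasurable
  have hlocd : LocallyIntegrable (u - g) := hloc.sub hgcont.locallyIntegrable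
  have h1 : eLpNorm (mollify (ρ m) (u - g)) 2 volume ≤ ENNReal.ofReal η :=
    ((hρ m).eLpNorm_mollify_le (hu.1.sub hg2.1)).trans hgu
  have h3 : eLpNorm (g - u) 2 volume ≤ ENNReal.ofReal η := by
    rw [eLpNorm_sub_comm]; exact hgu
  have h2 : eLpNorm (mollify (ρ m) g - g) 2 volume ≤ ENNReal.ofReal η := by
    have hb := eLpNorm_sub_le_of_dist_bdd volume (p := 2) (by norm_num) hKc.measurableSet hκ0.le
      (f := mollify (ρ m) g) (g := g) (s := K) ?_ ?_ ?_
    · refine hb.trans ?_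
      have hVe : volume K ^ (1 / (2 : ENNReal).toReal) = ENNReal.ofReal V := by
        rw [hV, ← ENNReal.ofReal_rpow_of_nonneg ENNReal.toReal_nonneg (by norm_num),
          ENNReal.ofReal_toReal hKm]
        norm_num
      rw [hVe, ← ENNReal.ofReal_mul hκ0.le]
      refine ENNReal.ofReal_le_ofReal ?_
      rw [hκ, div_mul_eq_mul_div, div_le_iff₀ (by positivity)]
      nlinarith
    · intro x
      refine (hρ m).dist_mollify_le hκ0.le (hρr m) hgcont.aestronglyMeasurable fun y hy => ?_
      exact (hδ ((Metric.mem_ball.1 hy).trans hm1)).le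
    · refine (support_mollify_subset (hρr m) g).trans ?_
      exact (Metric.thickening_mono hm2.le _).trans (Metric.thickening_subset_cthickening _ _)
    · exact (subset_tsupport g).trans (Metric.self_subset_cthickening _)
  rw [hsplit, ← hηε]
  refine (eLpNorm_add_le ((hmoll _ hlocd).add ((hmoll _ hgcont.locallyIntegrable).sub hg2.1))
    (hg2.1.sub hu.1) (by norm_num)).trans (add_le_add ?_ h3)
  exact (eLpNorm_add_le (hmoll _ hlocd) ((hmoll _ hgcont.locallyIntegrable).sub hg2.1)
    (by norm_num)).trans (add_le_add h1 h2)

/-! ### Density of smooth functions -/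

theorem TendstoL2.mono_measure {μ ν : Measure (E d)} (hμν : ν ≤ μ) {f : ℕ → Fld d} {g : Fld d}
    (h : TendstoL2 μ f g) : TendstoL2 ν f g :=
  tendsto_of_tendsto_of_tendsto_of_le_of_le tendsto_const_nhds h (fun _ => zero_le)
    fun _ => eLpNorm_mono_measure _ hμν

theorem TendstoL2.congr {μ : Measure (E d)} {f f' : ℕ → Fld d} {g g' : Fld d}
    (h : TendstoL2 μ f g) (hf : ∀ m, f m =ᵐ[μ] f' m) (hg : g =ᵐ[μ] g') : TendstoL2 μ f' g' := by
  refine Tendsto.congr (fun m => eLpNorm_congr_ae ?_) h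
  filter_upwards [hf m, hg] with x h1 h2
  rw [h1, h2]

theorem TendstoL2.finsetSum {ι : Type*} {s : Finset ι} {μ : Measure (E d)} {f : ι → ℕ → Fld d}
    {g : ι → Fld d} (hf : ∀ i ∈ s, ∀ m, AEStronglyMeasurable (f i m) μ)
    (hg : ∀ i ∈ s, AEStronglyMeasurable (g i) μ) (h : ∀ i ∈ s, TendstoL2 μ (f i) (g i)) :
    TendstoL2 μ (fun m x => ∑ i ∈ s, f i m x) (fun x => ∑ i ∈ s, g i x) := by
  have hlim : Tendsto (fun m => ∑ i ∈ s, eLpNorm (fun x => f i m x - g i x) 2 μ) atTop (𝓝 0) := by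
    simpa using tendsto_finsetSum s h
  refine tendsto_of_tendsto_of_tendsto_of_le_of_le tendsto_const_nhds hlim (fun _ => zero_le)
    fun m => ?_
  have : (fun x => ∑ i ∈ s, f i m x - ∑ i ∈ s, g i x) = ∑ i ∈ s, fun x => f i m x - g i x := by
    ext x
    simp [Finset.sum_apply]
  change eLpNorm (fun x => ∑ i ∈ s, f i m x - ∑ i ∈ s, g i x) 2 μ ≤ _
  rw [this]
  exact eLpNorm_sum_le (fun i hi => (hf i hi m).sub (hg i hi)) (by norm_num)

/-- A Lipschitz domain can locally be shifted into itself. -/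
theorem HasLipschitzBoundary.exists_shift {Ω : Set (E d)} (hΩ : IsOpen Ω)
    (hL : HasLipschitzBoundary Ω) {x₀ : E d} (hx₀ : x₀ ∈ closure Ω) :
    ∃ (ν : E d) (r κ : ℝ), ‖ν‖ ≤ 1 ∧ 0 < r ∧ 0 < κ ∧ κ ≤ 1 ∧
      ∀ y ∈ Ω, y ∈ Metric.ball x₀ r → ∀ ε > 0, ∀ w, ‖w - ε • ν‖ ≤ κ * ε →
        y - w ∈ Metric.ball x₀ r → y - w ∈ Ω := by
  by_cases hmem : x₀ ∈ Ω
  · obtain ⟨r, hr, hball⟩ := Metric.isOpen_iff.1 hΩ x₀ hmem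
    -- At an interior point the ball already lies in `Ω`, so no shift is needed.
    exact ⟨0, r, 1, by simp, hr, one_pos, le_rfl, fun y _ _ ε _ w _ hw => hball hw⟩
  · obtain ⟨ν, hν, r, hr, K, ζ, hζ, hinv, hloc⟩ :=
      hL x₀ ⟨hx₀, fun h => hmem (interior_subset h)⟩
    have hpos : (0 : ℝ) < 1 + K := by positivity
    have hκ1 : (1 + (K : ℝ))⁻¹ ≤ 1 := inv_le_one_of_one_le₀ (by simp)
    -- The constant balances two effects: subtracting `w` lowers the height by at least `(1 - κ) *
    -- ε`, and the graph drops by at most `K * κ * ε`. These are equal for `κ = (1 + K)⁻¹`.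
    refine ⟨ν, r, (1 + K)⁻¹, hν.le, hr, by positivity, hκ1, fun y hy hyb ε hε w hw hwb => ?_⟩
    set κ : ℝ := (1 + K)⁻¹ with hκ
    have hκK : κ * (1 + K) = 1 := inv_mul_cancel₀ hpos.ne'
    rw [hloc _ hwb]
    have h1 := (hloc _ hyb).1 hy
    have h2 : ζ (y - w) = ζ (y - (w - ε • ν)) := by
      rw [← hinv (y - w) ε]
      congr 1
      module
    have h3 : ζ y - K * (κ * ε) ≤ ζ (y - (w - ε • ν)) := by
      have h4 := hζ.dist_le_mul y (y - (w - ε • ν))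
      have h5 : dist y (y - (w - ε • ν)) = ‖w - ε • ν‖ := by rw [dist_eq_norm]; congr 1; abel
      rw [h5, Real.dist_eq] at h4
      have h6 : (K : ℝ) * ‖w - ε • ν‖ ≤ K * (κ * ε) := by gcongr
      linarith [(abs_le.1 h4).2]
    have h7 : inner ℝ ν w ≥ ε - κ * ε := by
      have h8 : inner ℝ ν w = ε + inner ℝ ν (w - ε • ν) := by
        rw [inner_sub_right, inner_smul_right, real_inner_self_eq_norm_sq, hν]
        ring
      have h9 := abs_real_inner_le_norm ν (w - ε • ν)
      rw [hν, one_mul] at h9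
      linarith [(abs_le.1 h9).1]
    have h8 : ε - κ * ε = K * (κ * ε) := by
      have : κ * ε * (1 + K) = ε := by rw [mul_right_comm, hκK, one_mul]
      linarith
    rw [inner_sub_right, h2]
    linarith

theorem pd_comp_const_sub {ρ : Fld d} {x z : E d} (hρ : DifferentiableAt ℝ ρ (x - z))
    (j : Fin d) : pd j (fun z => ρ (x - z)) z = - pd j ρ (x - z) := by
  have h := hρ.hasFDerivAt.comp z ((hasFDerivAt_id z).const_sub x)
  have h' : fderiv ℝ (fun z => ρ (x - z)) z = _ := h.fderiv
  simp [pd, h']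

theorem isTest_mul_comp_const_sub {Ω : Set (E d)} {χ ρ : Fld d} (hχ : ContDiff ℝ ∞ χ)
    (hχc : HasCompactSupport χ) (hρ : ContDiff ℝ ∞ ρ) {x : E d}
    (hx : ∀ z ∈ tsupport χ, x - z ∈ tsupport ρ → z ∈ Ω) :
    IsTest Ω (fun z => χ z * ρ (x - z)) := by
  refine ⟨hχ.mul (hρ.comp (contDiff_const.sub contDiff_id)), hχc.mul_right, fun z hz => ?_⟩
  refine hx z (closure_mono (Function.support_mul_subset_left _ _) hz) ?_
  have hcl : IsClosed {z | x - z ∈ tsupport ρ} :=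
    (isClosed_tsupport ρ).preimage (continuous_const.sub continuous_id)
  refine closure_minimal (fun y hy => ?_) hcl hz
  exact subset_tsupport ρ (fun h0 => hy (by simp only [h0, mul_zero]))

theorem memLp_indicator_mul {Ω : Set (E d)} (hΩ : MeasurableSet Ω) {v χ : Fld d}
    (hv : MemLp v 2 (vol Ω)) (hχ : Continuous χ) (hχc : HasCompactSupport χ) :
    MemLp (Ω.indicator fun z => χ z * v z) 2 volume := by
  rw [memLp_indicator_iff_restrict hΩ]
  obtain ⟨C, hC⟩ := hχc.exists_bound_of_continuous hχ
  refine (hv.const_mul C).mono (hχ.aestronglyMeasurable.mul hv.1)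
    (Eventually.of_forall fun x => ?_)
  simp only [norm_mul]
  gcongr
  exact (hC x).trans (le_abs_self C)

/-- Mollification commutes with weak derivatives at points whose mollified values only depend on
values inside the domain. -/
theorem pd_mollify_indicator {Ω : Set (E d)} (hΩ : IsOpen Ω) {v g χ ρ : Fld d} {j : Fin d}
    (hv : MemLp v 2 (vol Ω)) (hg : MemLp g 2 (vol Ω))
    (hweak : ∀ φ : Fld d, IsTest Ω φ → ∫ x in Ω, v x * pd j φ x = - ∫ x in Ω, g x * φ x)
    (hχ : ContDiff ℝ ∞ χ) (hχc : HasCompactSupport χ) (hρ : IsMollifier ρ) {x : E d}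
    (hx : ∀ z ∈ tsupport χ, x - z ∈ tsupport ρ → z ∈ Ω) :
    pd j (mollify ρ (Ω.indicator fun z => χ z * v z)) x =
      mollify ρ (Ω.indicator fun z => χ z * g z + pd j χ z * v z) x := by
  have hΩm := hΩ.measurableSet
  have hloc : LocallyIntegrable (Ω.indicator fun z => χ z * v z) :=
    (memLp_indicator_mul hΩm hv hχ.continuous hχc).locallyIntegrable (by norm_num)
  have hρx : ContDiff ℝ ∞ (fun z => ρ (x - z)) := hρ.contDiff.comp (contDiff_const.sub contDiff_id)
  have hρ'x : Continuous (fun z => pd j ρ (x - z)) :=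
    (contDiff_pd hρ.contDiff j).continuous.comp (by fun_prop)
  have hconv : ∀ a b : Fld d, ∫ z, a z * Ω.indicator b z = ∫ z in Ω, a z * b z := by
    intro a b
    rw [← integral_indicator hΩm]
    congr 1
    ext z
    by_cases hz : z ∈ Ω <;> simp [hz]
  have hint : ∀ {w a : Fld d}, MemLp w 2 (vol Ω) → Continuous a → HasCompactSupport a →
      Integrable (fun z => w z * a z) (vol Ω) := by
    intro w a hw ha hac
    exact hw.integrable_mul (ha.memLp_of_hasCompactSupport (p := 2) hac)
  have hχ' := (contDiff_pd hχ j).continuous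
  have hχ'c := hasCompactSupport_pd hχc j
  rw [pd_mollify hρ.contDiff hρ.hasCompactSupport hloc, mollify, hconv, hconv]
  -- The weak derivative is tested with `z ↦ χ z * ρ (x - z)`, which is admissible by `hx`. The
  -- product rule produces the extra term `pd j χ * v`, and reflection of the argument supplies the
  -- sign.
  have key := hweak _ (isTest_mul_comp_const_sub hχ hχc hρ.contDiff hx)
  have hpd : ∀ z, pd j (fun z => χ z * ρ (x - z)) z =
      pd j χ z * ρ (x - z) - χ z * pd j ρ (x - z) := by
    intro z
    rw [pd_mul (hχ.differentiable (by simp) z) (hρx.differentiable (by simp) z),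
      pd_comp_const_sub (hρ.contDiff.differentiable (by simp) _)]
    ring
  simp only [hpd, mul_sub] at key
  have i1 := hint (a := fun z => pd j χ z * ρ (x - z)) hv (hχ'.mul hρx.continuous) hχ'c.mul_right
  have i2 := hint (a := fun z => χ z * pd j ρ (x - z)) hv (hχ.continuous.mul hρ'x) hχc.mul_right
  have i3 := hint (a := fun z => χ z * ρ (x - z)) hg (hχ.continuous.mul hρx.continuous) hχc.mul_right
  rw [integral_sub i1 i2] at key
  have e1 : ∫ z in Ω, pd j ρ (x - z) * (χ z * v z) = ∫ z in Ω, v z * (χ z * pd j ρ (x - z)) := by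
    congr 1; ext z; ring
  have e2 : ∫ z in Ω, ρ (x - z) * (χ z * g z + pd j χ z * v z) =
      (∫ z in Ω, g z * (χ z * ρ (x - z))) + ∫ z in Ω, v z * (pd j χ z * ρ (x - z)) := by
    rw [← integral_add i3 i1]
    congr 1; ext z; ring
  rw [e1, e2]
  linarith

/-- Bumps of radius `κ * ε` centred at `ε • ν` rather than at the origin: the mollified value at `y
∈ Ω` samples only points `y - w` with `w` as allowed in `exists_shift`. -/
theorem exists_mollifiers {ν : E d} (hν : ‖ν‖ ≤ 1) {r κ : ℝ} (hr : 0 < r) (hκ : 0 < κ)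
    (hκ1 : κ ≤ 1) :
    ∃ ρ : ℕ → Fld d, (∀ m, IsMollifier (ρ m)) ∧
      (∀ m, Function.support (ρ m) ⊆ Metric.ball 0 (r * (1 / ((m : ℝ) + 1)))) ∧
      ∀ m, ∃ ε > 0, 2 * ε ≤ r ∧ ∀ w ∈ tsupport (ρ m), ‖w - ε • ν‖ ≤ κ * ε := by
  have hm : ∀ m : ℕ, 0 < r * (1 / ((m : ℝ) + 1)) := fun m => by positivity
  set ε : ℕ → ℝ := fun m => r * (1 / ((m : ℝ) + 1)) / 2 with hε
  have hε0 : ∀ m, 0 < ε m := fun m => half_pos (hm m)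
  let b : ∀ m, ContDiffBump (ε m • ν) := fun m =>
    ⟨κ * ε m / 2, κ * ε m, half_pos (mul_pos hκ (hε0 m)), half_lt_self (mul_pos hκ (hε0 m))⟩
  refine ⟨fun m => (b m).normed volume, fun m => ⟨(b m).contDiff_normed,
    (b m).hasCompactSupport_normed, (b m).nonneg_normed, (b m).integral_normed⟩, fun m => ?_,
    fun m => ⟨ε m, hε0 m, ?_, fun w hw => ?_⟩⟩
  · rw [(b m).support_normed_eq]
    intro w hw
    rw [mem_ball_zero_iff]
    have h1 : ‖w - ε m • ν‖ < κ * ε m := by rwa [← dist_eq_norm]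
    have h2 : ‖ε m • ν‖ ≤ ε m := by
      rw [norm_smul, Real.norm_of_nonneg (hε0 m).le]
      exact mul_le_of_le_one_right (hε0 m).le hν
    have h3 : κ * ε m ≤ ε m := mul_le_of_le_one_left (hε0 m).le hκ1
    have h4 := norm_add_le (w - ε m • ν) (ε m • ν)
    rw [sub_add_cancel] at h4
    have : r * (1 / ((m : ℝ) + 1)) = 2 * ε m := by simp only [hε]; ring
    linarith
  · have h1 : 1 / ((m : ℝ) + 1) ≤ 1 := by
      rw [div_le_one (by positivity)]; simp
    have : 2 * ε m = r * (1 / ((m : ℝ) + 1)) := by simp only [hε]; ring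
    rw [this]
    exact mul_le_of_le_one_right hr.le h1
  · rw [(b m).tsupport_normed_eq] at hw
    rwa [← dist_eq_norm]

/-- Smooth functions are dense in `H¹` of a bounded Lipschitz domain. -/
theorem exists_smooth_tendstoL2 {Ω : Set (E d)} (hΩ : IsOpen Ω) (hb : Bornology.IsBounded Ω)
    (hL : HasLipschitzBoundary Ω) {v : Fld d} {g : Fin d → Fld d} (hv : MemLp v 2 (vol Ω))
    (hg : ∀ j, MemLp (g j) 2 (vol Ω))
    (hweak : ∀ j, ∀ φ : Fld d, IsTest Ω φ →
      ∫ x in Ω, v x * pd j φ x = - ∫ x in Ω, g j x * φ x) :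
    ∃ φ : ℕ → Fld d, (∀ m, ContDiff ℝ ∞ (φ m)) ∧ TendstoL2 (vol Ω) φ v ∧
      ∀ j, TendstoL2 (vol Ω) (fun m => pd j (φ m)) (g j) := by
  have hΩm := hΩ.measurableSet
  choose! ν r κ hν hr hκ hκ1 hshift using fun x (hx : x ∈ closure Ω) => hL.exists_shift hΩ hx
  -- Half of `r x` is reserved for the support of `χ x` and half for the mollifier, so every `y`
  -- that sees this support stays in the ball where the shift property holds.
  obtain ⟨t, χ, htK, hχ, hsum⟩ := exists_smooth_partition hb.isCompact_closure
    (r := fun x => r x / 2) fun x hx => half_pos (hr x hx)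
  have hχc : ∀ x ∈ t, HasCompactSupport (χ x) := fun x hx =>
    (isCompact_closedBall x (r x / 2)).of_isClosed_subset (isClosed_tsupport _)
      ((hχ x hx).2.2.trans Metric.ball_subset_closedBall)
  choose! ρ hρ hρs hρt using fun x (hx : x ∈ t) =>
    exists_mollifiers (hν x (htK x hx)) (half_pos (hr x (htK x hx))) (hκ x (htK x hx))
      (hκ1 x (htK x hx))
  have hrad : ∀ x, Tendsto (fun m : ℕ => r x / 2 * (1 / ((m : ℝ) + 1))) atTop (𝓝 0) := fun x => by
    simpa using tendsto_one_div_add_atTop_nhds_zero_nat.const_mul (r x / 2)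
  set u : E d → Fld d := fun x => Ω.indicator fun z => χ x z * v z with hu
  set u' : Fin d → E d → Fld d := fun j x =>
    Ω.indicator fun z => χ x z * g j z + pd j (χ x) z * v z with hu'
  have huL : ∀ x ∈ t, MemLp (u x) 2 volume := fun x hx =>
    memLp_indicator_mul hΩm hv (hχ x hx).1.continuous (hχc x hx)
  have hu'L : ∀ j, ∀ x ∈ t, MemLp (u' j x) 2 volume := by
    intro j x hx
    have h1 := memLp_indicator_mul hΩm (hg j) (hχ x hx).1.continuous (hχc x hx)
    have h2 := memLp_indicator_mul hΩm hv (contDiff_pd (hχ x hx).1 j).continuous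
      (hasCompactSupport_pd (hχc x hx) j)
    have h3 := h1.add h2
    rwa [← Set.indicator_add'] at h3
  have hloc : ∀ {w : Fld d}, MemLp w 2 volume → LocallyIntegrable w := fun hw =>
    hw.locallyIntegrable (by norm_num)
  have hsm : ∀ x ∈ t, ∀ m, ∀ {w : Fld d}, MemLp w 2 volume →
      ContDiff ℝ ∞ (mollify (ρ x m) w) := fun x hx m w hw =>
    contDiff_mollify (hρ x hx m).contDiff (hρ x hx m).hasCompactSupport (hloc hw)
  have hconv : ∀ {w : E d → Fld d}, (∀ x ∈ t, MemLp (w x) 2 volume) →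
      TendstoL2 (vol Ω) (fun m y => ∑ x ∈ t, mollify (ρ x m) (w x) y)
        (fun y => ∑ x ∈ t, w x y) := by
    intro w hw
    refine TendstoL2.mono_measure (μ := volume) Measure.restrict_le_self ?_
    exact TendstoL2.finsetSum
      (fun x hx m => (hsm x hx m (hw x hx)).continuous.aestronglyMeasurable)
      (fun x hx => (hw x hx).1)
      (fun x hx => tendstoL2_mollify (hρ x hx) (hρs x hx) (hrad x) (hw x hx))
  refine ⟨fun m y => ∑ x ∈ t, mollify (ρ x m) (u x) y,
    fun m => ContDiff.sum fun x hx => hsm x hx m (huL x hx), ?_, fun j => ?_⟩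
  · refine (hconv huL).congr (fun m => EventuallyEq.rfl) ?_
    filter_upwards [ae_restrict_mem hΩm] with y hy
    simp only [hu, Set.indicator_of_mem hy]
    rw [← Finset.sum_mul, hsum y (subset_closure hy), one_mul]
  · refine (hconv (hu'L j)).congr (fun m => ?_) ?_
    · filter_upwards [ae_restrict_mem hΩm] with y hy
      have hpdsum : pd j (fun y => ∑ x ∈ t, mollify (ρ x m) (u x) y) y =
          ∑ x ∈ t, pd j (mollify (ρ x m) (u x)) y := by
        simp only [pd]
        rw [fderiv_fun_sum fun x hx => (hsm x hx m (huL x hx)).differentiable (by simp) y]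
        simp
      rw [hpdsum]
      refine Finset.sum_congr rfl fun x hx => ?_
      refine (pd_mollify_indicator hΩ hv (hg j) (hweak j) (hχ x hx).1 (hχc x hx) (hρ x hx m)
        fun z hz hyz => ?_).symm
      obtain ⟨ε, hε, hεr, hw⟩ := hρt x hx m
      have hzb := Metric.mem_ball.1 ((hχ x hx).2.2 hz)
      have hyz' := hw _ hyz
      have hnorm : ‖y - z‖ ≤ 2 * ε := by
        have h1 := norm_add_le (y - z - ε • ν x) (ε • ν x)
        rw [sub_add_cancel] at h1
        have h2 : ‖ε • ν x‖ ≤ ε := by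
          rw [norm_smul, Real.norm_of_nonneg hε.le]
          exact mul_le_of_le_one_right hε.le (hν x (htK x hx))
        have h3 : κ x * ε ≤ ε := mul_le_of_le_one_left hε.le (hκ1 x (htK x hx))
        linarith
      have hyb : y ∈ Metric.ball x (r x) := by
        rw [Metric.mem_ball]
        have h1 := dist_triangle y z x
        rw [dist_eq_norm y z] at h1
        linarith
      have hzb' : y - (y - z) ∈ Metric.ball x (r x) := by
        rw [sub_sub_cancel, Metric.mem_ball]
        linarith [hr x (htK x hx)]
      have := hshift x (htK x hx) y hy hyb ε hε (y - z) hyz' hzb'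
      rwa [sub_sub_cancel] at this
    · filter_upwards [ae_restrict_mem hΩm] with y hy
      simp only [hu', Set.indicator_of_mem hy]
      rw [Finset.sum_add_distrib, ← Finset.sum_mul, ← Finset.sum_mul,
        hsum y (subset_closure hy), one_mul]
      -- The product-rule terms cancel because the partition sums to the constant `1` near `y`.
      have hpd0 : ∑ x ∈ t, pd j (χ x) y = 0 := by
        have h1 : (fun y => ∑ x ∈ t, χ x y) =ᶠ[𝓝 y] fun _ => 1 := by
          filter_upwards [hΩ.mem_nhds hy] with z hz using hsum z (subset_closure hz)
        have h2 : fderiv ℝ (fun y => ∑ x ∈ t, χ x y) y = 0 := by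
          rw [h1.fderiv_eq]; simp
        rw [fderiv_fun_sum fun x hx => (hχ x hx).1.differentiable (by simp) y] at h2
        have h3 := congrArg (fun L : E d →L[ℝ] ℝ => L (EuclideanSpace.single j 1)) h2
        simpa [pd] using h3
      rw [hpd0, zero_mul, add_zero]

/-! ### Existence of traces -/

theorem ofReal_integral_sq {α : Type*} {_ : MeasurableSpace α} {f : α → ℝ} {μ : Measure α}
    (hf : Integrable (fun x => f x ^ 2) μ) :
    ENNReal.ofReal (∫ x, f x ^ 2 ∂μ) = eLpNorm f 2 μ ^ 2 := by
  rw [lintegral_enorm_sq_eq,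
    ofReal_integral_eq_lintegral_ofReal hf (Eventually.of_forall fun x => sq_nonneg (f x))]
  refine lintegral_congr fun x => ?_
  rw [← sq_abs, ENNReal.ofReal_pow (abs_nonneg _), ← Real.norm_eq_abs, ofReal_norm]

theorem sum_enn_sq_le_sq_sum {ι : Type*} (s : Finset ι) (b : ι → ENNReal) :
    ∑ j ∈ s, b j ^ 2 ≤ (∑ j ∈ s, b j) ^ 2 := by
  rw [sq, Finset.sum_mul]
  refine Finset.sum_le_sum fun j hj => ?_
  rw [sq]
  gcongr
  exact Finset.single_le_sum (f := b) (fun _ _ => zero_le) hj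

theorem ofReal_integral_sobolevSq_le {T : Set (E d)} (hT : Bornology.IsBounded T) {φ : Fld d}
    (hφ : ContDiff ℝ ∞ φ) :
    ENNReal.ofReal (∫ x in T, sobolevSq φ x) ≤
      (eLpNorm φ 2 (vol T) + ∑ j, eLpNorm (pd j φ) 2 (vol T)) ^ 2 := by
  have i1 : Integrable (fun x => φ x ^ 2) (vol T) :=
    integrable_vol_of_continuous hT (hφ.continuous.pow 2)
  have i2 : ∀ j, Integrable (fun x => pd j φ x ^ 2) (vol T) := fun j =>
    integrable_vol_of_continuous hT ((contDiff_pd hφ j).continuous.pow 2)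
  have h1 : ENNReal.ofReal (∫ x in T, sobolevSq φ x) =
      eLpNorm φ 2 (vol T) ^ 2 + ∑ j, eLpNorm (pd j φ) 2 (vol T) ^ 2 := by
    simp only [sobolevSq]
    rw [integral_add i1 (integrable_finsetSum _ fun j _ => i2 j),
      integral_finsetSum _ fun j _ => i2 j, ENNReal.ofReal_add (integral_nonneg fun x => sq_nonneg _)
      (Finset.sum_nonneg fun j _ => integral_nonneg fun x => sq_nonneg _),
      ENNReal.ofReal_sum_of_nonneg fun j _ => integral_nonneg fun x => sq_nonneg _,
      ofReal_integral_sq i1]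
    congr 1
    exact Finset.sum_congr rfl fun j _ => ofReal_integral_sq (i2 j)
  rw [h1, add_sq]
  refine add_le_add (le_add_of_nonneg_right zero_le) (sum_enn_sq_le_sq_sum _ _)

namespace PolyhedralMesh

variable {Ω : Set (E d)} (M : PolyhedralMesh Ω)

theorem face_isCompact {e : Set (E d)} (he : e ∈ M.faces) : IsCompact e := by
  obtain ⟨T, hT, heT⟩ := M.face_of_elem e he
  exact (M.face_flat T hT e he heT).1

theorem isCompact_skeleton : IsCompact M.skeleton :=
  M.faces.isCompact_biUnion fun _ he => M.face_isCompact he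

theorem frontier_subset_skeleton {T : Set (E d)} (hT : T ∈ M.elems) :
    frontier T ⊆ M.skeleton := by
  rw [M.frontier_eq T hT]
  intro x hx
  simp only [Set.mem_iUnion] at hx
  obtain ⟨e, he, hxe⟩ := hx
  exact Set.mem_biUnion he.1 hxe

theorem face_subset_skeleton {e : Set (E d)} (he : e ∈ M.faces) : e ⊆ M.skeleton :=
  Set.subset_biUnion_of_mem (u := fun e => e) he

/-- Only an inequality, since a face shared by two elements is counted twice; it suffices to sum the
trace inequalities of the elements. -/
theorem surf_skeleton_le : surf M.skeleton ≤ ∑ T ∈ M.elems, surf (frontier T) := by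
  have hsub : M.skeleton ⊆ ⋃ T : M.elems, frontier (T : Set (E d)) := by
    intro x hx
    simp only [skeleton, Set.mem_iUnion] at hx
    obtain ⟨e, he, hxe⟩ := hx
    obtain ⟨T, hT, heT⟩ := M.face_of_elem e he
    exact Set.mem_iUnion.2 ⟨⟨T, hT⟩, heT hxe⟩
  rw [← Finset.sum_coe_sort, ← Measure.sum_fintype]
  exact (Measure.restrict_mono hsub le_rfl).trans (Measure.restrict_iUnion_le)

theorem isFiniteMeasure_surf_skeleton : IsFiniteMeasure (surf M.skeleton) := by
  refine ⟨(Measure.le_iff'.1 M.surf_skeleton_le _).trans_lt ?_⟩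
  rw [Measure.finsetSum_apply]
  refine ENNReal.sum_lt_top.2 fun T hT => ?_
  obtain ⟨n, c, h⟩ := M.exists_flatBoundary hT
  have := h.isFiniteMeasure_surf_frontier
  exact measure_lt_top _ _

theorem memLp_surf_skeleton_of_continuous {f : Fld d} (hf : Continuous f) :
    MemLp f 2 (surf M.skeleton) := by
  have := M.isFiniteMeasure_surf_skeleton
  obtain ⟨C, hC⟩ := M.isCompact_skeleton.exists_bound_of_continuousOn hf.continuousOn
  refine MemLp.of_bound hf.aestronglyMeasurable C ?_
  filter_upwards [ae_restrict_mem M.isCompact_skeleton.measurableSet] with x hx using hC x hx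

/-- The trace inequality on the skeleton. -/
theorem exists_trace_inequality :
    ∃ C : ENNReal, C ≠ ⊤ ∧ ∀ φ : Fld d, ContDiff ℝ ∞ φ → eLpNorm φ 2 (surf M.skeleton) ≤
      C * (eLpNorm φ 2 (vol Ω) + ∑ j, eLpNorm (pd j φ) 2 (vol Ω)) := by
  have hT : ∀ T ∈ M.elems, ∃ C : ℝ, 0 ≤ C ∧ ∀ φ : Fld d, ContDiff ℝ ∞ φ →
      ∫ x, φ x ^ 2 ∂(surf (frontier T)) ≤ C * ∫ x in T, sobolevSq φ x := by
    intro T hT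
    obtain ⟨n, c, h⟩ := M.exists_flatBoundary hT
    exact h.exists_trace_inequality (M.elem_polyhedral T hT).lipschitz
  choose! C hC0 hC using hT
  set B : ENNReal := ∑ T ∈ M.elems, ENNReal.ofReal (C T) with hB
  have hBt : B ≠ ⊤ := ENNReal.sum_ne_top.2 fun T _ => ENNReal.ofReal_ne_top
  -- `B ≤ (B + 1) ^ 2` avoids a square root of `B`.
  refine ⟨B + 1, ENNReal.add_ne_top.2 ⟨hBt, ENNReal.one_ne_top⟩, fun φ hφ => ?_⟩
  refine (ENNReal.pow_le_pow_left_iff two_ne_zero).1 ?_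
  set N : ENNReal := eLpNorm φ 2 (vol Ω) + ∑ j, eLpNorm (pd j φ) 2 (vol Ω) with hN
  calc eLpNorm φ 2 (surf M.skeleton) ^ 2
      = ∫⁻ x, ‖φ x‖ₑ ^ 2 ∂(surf M.skeleton) := lintegral_enorm_sq_eq _ _
    _ ≤ ∫⁻ x, ‖φ x‖ₑ ^ 2 ∂(∑ T ∈ M.elems, surf (frontier T)) :=
        lintegral_mono' M.surf_skeleton_le le_rfl
    _ = ∑ T ∈ M.elems, eLpNorm φ 2 (surf (frontier T)) ^ 2 := by
        rw [lintegral_finsetSum_measure]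
        exact Finset.sum_congr rfl fun T _ => (lintegral_enorm_sq_eq _ _).symm
    _ ≤ ∑ T ∈ M.elems, ENNReal.ofReal (C T) * N ^ 2 := by
        refine Finset.sum_le_sum fun T hT => ?_
        obtain ⟨n, c, h⟩ := M.exists_flatBoundary hT
        rw [← ofReal_integral_sq (h.integrable_surf_frontier_of_continuous (hφ.continuous.pow 2))]
        refine (ENNReal.ofReal_le_ofReal (hC T hT φ hφ)).trans ?_
        rw [ENNReal.ofReal_mul (hC0 T hT)]
        gcongr
        refine (ofReal_integral_sobolevSq_le h.isBounded hφ).trans ?_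
        have hle : vol T ≤ vol Ω := Measure.restrict_mono (M.elem_subset T hT) le_rfl
        gcongr
        refine add_le_add (eLpNorm_mono_measure _ hle) ?_
        exact Finset.sum_le_sum fun j _ => eLpNorm_mono_measure _ hle
    _ = B * N ^ 2 := by rw [hB, Finset.sum_mul]
    _ ≤ ((B + 1) * N) ^ 2 := by
        rw [mul_pow]
        gcongr
        calc B ≤ B + 1 := le_self_add
          _ = (B + 1) * 1 := (mul_one _).symm
          _ ≤ (B + 1) * (B + 1) := by gcongr; exact le_add_self
          _ = (B + 1) ^ 2 := (sq _).symm

end PolyhedralMesh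

theorem pd_sub {f g : Fld d} (hf : ContDiff ℝ ∞ f) (hg : ContDiff ℝ ∞ g) (j : Fin d) (x : E d) :
    pd j (fun x => f x - g x) x = pd j f x - pd j g x := by
  simp only [pd]
  rw [fderiv_fun_sub (hf.differentiable (by simp) x) (hg.differentiable (by simp) x)]
  simp

theorem TendstoL2.tendsto_prod {μ : Measure (E d)} {f : ℕ → Fld d} {g : Fld d}
    (hf : ∀ m, AEStronglyMeasurable (f m) μ) (hg : AEStronglyMeasurable g μ)
    (h : TendstoL2 μ f g) :
    Tendsto (fun p : ℕ × ℕ => eLpNorm (fun x => f p.1 x - f p.2 x) 2 μ) atTop (𝓝 0) := by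
  have h1 : Tendsto (fun p : ℕ × ℕ => eLpNorm (fun x => f p.1 x - g x) 2 μ +
      eLpNorm (fun x => f p.2 x - g x) 2 μ) atTop (𝓝 0) := by
    have := (h.comp (tendsto_fst (f := atTop) (g := atTop))).add
      (h.comp (tendsto_snd (f := atTop) (g := atTop)))
    rw [prod_atTop_atTop_eq] at this
    simpa using this
  refine tendsto_of_tendsto_of_tendsto_of_le_of_le tendsto_const_nhds h1 (fun _ => zero_le)
    fun p => ?_
  have : (fun x => f p.1 x - f p.2 x) = (fun x => f p.1 x - g x) - fun x => f p.2 x - g x := by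
    ext x; simp
  change eLpNorm (fun x => f p.1 x - f p.2 x) 2 μ ≤ _
  rw [this]
  exact eLpNorm_sub_le ((hf _).sub hg) ((hf _).sub hg) (by norm_num)

/-- The trace inequality for the differences `φ m - φ m'` makes the restrictions Cauchy in `L²` of
the skeleton, which is complete. -/
theorem PolyhedralMesh.exists_trace_of_tendstoL2 {Ω : Set (E d)} (M : PolyhedralMesh Ω) {v : Fld d}
    {g : Fin d → Fld d} (hv : MemLp v 2 (vol Ω)) (hg : ∀ j, MemLp (g j) 2 (vol Ω))
    {φ : ℕ → Fld d} (hφ : ∀ m, ContDiff ℝ ∞ (φ m)) (hφv : TendstoL2 (vol Ω) φ v)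
    (hφg : ∀ j, TendstoL2 (vol Ω) (fun m => pd j (φ m)) (g j)) :
    ∃ w : Fld d, MemLp w 2 (surf M.skeleton) ∧ TendstoL2 (surf M.skeleton) φ w := by
  obtain ⟨C, hC, htr⟩ := M.exists_trace_inequality
  have hmem : ∀ m, MemLp (φ m) 2 (surf M.skeleton) := fun m =>
    M.memLp_surf_skeleton_of_continuous (hφ m).continuous
  have hlim : Tendsto (fun p : ℕ × ℕ => eLpNorm (fun x => φ p.1 x - φ p.2 x) 2 (surf M.skeleton))
      atTop (𝓝 0) := by
    have h1 := hφv.tendsto_prod (fun m => (hφ m).continuous.aestronglyMeasurable) hv.1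
    have h2 := fun j => (hφg j).tendsto_prod
      (fun m => (contDiff_pd (hφ m) j).continuous.aestronglyMeasurable) (hg j).1
    have h3 := ENNReal.Tendsto.const_mul (a := C)
      (h1.add (tendsto_finsetSum Finset.univ fun j _ => h2 j)) (Or.inr hC)
    simp only [Finset.sum_const_zero, add_zero, mul_zero] at h3
    refine tendsto_of_tendsto_of_tendsto_of_le_of_le tendsto_const_nhds h3 (fun _ => zero_le)
      fun p => ?_
    refine (htr _ ((hφ p.1).sub (hφ p.2))).trans_eq ?_
    congr 2
    refine Finset.sum_congr rfl fun j _ => ?_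
    congr 1
    ext x
    exact pd_sub (hφ _) (hφ _) j x
  have hcau : CauchySeq fun m => (hmem m).toLp (φ m) := by
    rw [cauchySeq_iff_tendsto_dist_atTop_0]
    have := (ENNReal.tendsto_toReal ENNReal.zero_ne_top).comp hlim
    refine this.congr fun p => ?_
    rw [dist_edist, Lp.edist_toLp_toLp]
    rfl
  obtain ⟨w, hw⟩ := cauchySeq_tendsto_of_complete hcau
  refine ⟨w, Lp.memLp w, ?_⟩
  rw [tendsto_iff_edist_tendsto_0] at hw
  refine hw.congr fun m => ?_
  rw [Lp.edist_def]
  refine eLpNorm_congr_ae ?_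
  filter_upwards [(hmem m).coeFn_toLp] with x hx
  simp [hx]

theorem PolyhedralMesh.exists_isTrace {Ω : Set (E d)} (hΩ : IsPolyhedralDomain Ω)
    (M : PolyhedralMesh Ω) {v : Fin d → Fld d} {G : Fin d → Fin d → Fld d} (h : IsH1 Ω v G) :
    ∃ vb, IsTrace Ω M.skeleton v G vb := by
  have : ∀ i, ∃ w : Fld d, MemLp w 2 (surf M.skeleton) ∧ ∃ φ : ℕ → Fld d,
      (∀ m, ContDiff ℝ ∞ (φ m)) ∧ TendstoL2 (vol Ω) φ (v i) ∧
      (∀ j, TendstoL2 (vol Ω) (fun m => pd j (φ m)) (G i j)) ∧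
      TendstoL2 (surf M.skeleton) φ w := by
    intro i
    obtain ⟨φ, hφ, hφv, hφg⟩ := exists_smooth_tendstoL2 hΩ.isOpen hΩ.isBounded hΩ.lipschitz
      (h.memLp i) (h.memLp_grad i) (h.weak i)
    obtain ⟨w, hw, hφw⟩ :=
      M.exists_trace_of_tendstoL2 (h.memLp i) (h.memLp_grad i) hφ hφv hφg
    exact ⟨w, hw, φ, hφ, hφv, hφg, hφw⟩
  choose vb hvb using this
  exact ⟨vb, hvb⟩

/-! ### Polynomials -/

theorem analyticOnNhd_of_mem_poly {r : ℕ} {p : Fld d} (hp : p ∈ Poly d r) :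
    AnalyticOnNhd ℝ p Set.univ := by
  obtain ⟨P, -, rfl⟩ := hp
  exact AnalyticOnNhd.eval_continuousLinearMap' (𝕜 := ℝ) (E := E d) (B := ℝ)
    (fun i => (EuclideanSpace.proj i : E d →L[ℝ] ℝ)) P

theorem contDiff_of_mem_poly {r : ℕ} {p : Fld d} (hp : p ∈ Poly d r) : ContDiff ℝ ∞ p :=
  contDiffOn_univ.1 (analyticOnNhd_of_mem_poly hp).contDiffOn_of_completeSpace

theorem poly_mono {r s : ℕ} (h : r ≤ s) : Poly d r ≤ Poly d s := by
  refine Submodule.map_mono fun P hP => ?_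
  rw [MvPolynomial.mem_restrictTotalDegree] at hP ⊢
  exact hP.trans h

theorem totalDegree_pderiv_le (j : Fin d) (P : MvPolynomial (Fin d) ℝ) :
    (MvPolynomial.pderiv j P).totalDegree ≤ P.totalDegree := by
  rw [← MvPolynomial.mem_restrictTotalDegree]
  have hsum : MvPolynomial.pderiv j P =
      ∑ s ∈ P.support, MvPolynomial.pderiv j (MvPolynomial.monomial s (P.coeff s)) := by
    rw [← map_sum, ← P.as_sum]
  rw [hsum]
  refine Submodule.sum_mem _ fun s hs => ?_
  rw [MvPolynomial.pderiv_monomial, MvPolynomial.mem_restrictTotalDegree]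
  refine (MvPolynomial.totalDegree_monomial_le _ _).trans ?_
  refine le_trans ?_ (MvPolynomial.le_totalDegree hs)
  exact Finsupp.degree_mono tsub_le_self

theorem pd_evalLin (j : Fin d) (P : MvPolynomial (Fin d) ℝ) :
    pd j (evalLin d P) = evalLin d (MvPolynomial.pderiv j P) := by
  have hd : ∀ Q : MvPolynomial (Fin d) ℝ, Differentiable ℝ (evalLin d Q) := fun Q =>
    (contDiff_of_mem_poly (r := Q.totalDegree) ⟨Q,
      (MvPolynomial.mem_restrictTotalDegree _ _ _).2 le_rfl, rfl⟩).differentiable (by simp)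
  ext x
  induction P using MvPolynomial.induction_on with
  | C a =>
    have : evalLin d (MvPolynomial.C a) = fun _ => a := by ext y; simp [evalLin]
    rw [this]
    simp [pd]
  | add p q hp hq =>
    rw [map_add, map_add, map_add, Pi.add_apply, ← hp, ← hq]
    simp only [pd]
    rw [fderiv_add (hd p x) (hd q x)]
    simp
  | mul_X p i hp =>
    have h1 : evalLin d (p * MvPolynomial.X i) = fun y => evalLin d p y * y i := by
      ext y; simp [evalLin]
    have h2 : HasFDerivAt (fun y : E d => y i) (EuclideanSpace.proj i : E d →L[ℝ] ℝ) x :=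
      (EuclideanSpace.proj i : E d →L[ℝ] ℝ).hasFDerivAt
    have h3 : pd j (fun y : E d => y i) x = if i = j then 1 else 0 := by
      rw [pd, h2.fderiv]
      simp
    rw [h1, pd_mul (hd p x) h2.differentiableAt, hp, h3, Derivation.leibniz, MvPolynomial.pderiv_X]
    by_cases hij : i = j
    · subst hij
      simp [evalLin]
      ring
    · simp [evalLin, hij]
      ring

/-- The drop of the degree is not recorded: for `r = k - 1`, membership in `P_r ⊆ P_k` is all that
testing against `Q₀` requires. -/
theorem pd_mem_poly {r : ℕ} {p : Fld d} (hp : p ∈ Poly d r) (j : Fin d) : pd j p ∈ Poly d r := by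
  obtain ⟨P, hP, rfl⟩ := hp
  refine ⟨MvPolynomial.pderiv j P, ?_, (pd_evalLin j P).symm⟩
  have hP : P.totalDegree ≤ r := (MvPolynomial.mem_restrictTotalDegree _ _ _).1 hP
  exact (MvPolynomial.mem_restrictTotalDegree _ _ _).2 ((totalDegree_pderiv_le j P).trans hP)

/-! ### Projections -/

theorem memLp_vol_of_continuous {T : Set (E d)} (hT : Bornology.IsBounded T) {f : Fld d}
    (hf : Continuous f) : MemLp f 2 (vol T) := by
  have h1 : MemLp f 2 (vol (closure T)) := by
    have : IsFiniteMeasure (vol (closure T)) :=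
      ⟨by simpa using hT.isCompact_closure.measure_lt_top⟩
    obtain ⟨C, hC⟩ := hT.isCompact_closure.exists_bound_of_continuousOn hf.continuousOn
    refine MemLp.of_bound hf.aestronglyMeasurable C ?_
    filter_upwards [ae_restrict_mem isClosed_closure.measurableSet] with x hx using hC x hx
  exact h1.mono_measure (Measure.restrict_mono subset_closure le_rfl)

theorem memLp_mul_integrable {μ : Measure (E d)} {f g : Fld d} (hf : MemLp f 2 μ)
    (hg : MemLp g 2 μ) : Integrable (fun x => f x * g x) μ :=
  hf.integrable_mul hg

theorem l2Proj_integral_mul {μ : Measure (E d)} {r : ℕ} {f : Fld d} (hf : MemLp f 2 μ)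
    (hP : ∀ q ∈ Poly d r, MemLp q 2 μ) {q : Fld d} (hq : q ∈ Poly d r) :
    ∫ x, l2Proj μ r f x * q x ∂μ = ∫ x, f x * q x ∂μ := by
  have h := l2Proj_spec hf hP
  have h2 := h.2 q hq
  simp only [sub_mul] at h2
  rw [integral_sub (memLp_mul_integrable hf (hP q hq))
    (memLp_mul_integrable (hP _ h.1) (hP q hq))] at h2
  linarith

/-- Testing with `p - p'` shows that it vanishes on `T`. Members of `Poly` are functions on the
whole space, so analyticity is used to extend the equality beyond the nonempty open set `T`. -/
theorem eq_of_integral_mul_eq {T : Set (E d)} (hT : IsOpen T) (hne : T.Nonempty)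
    (hb : Bornology.IsBounded T) {r : ℕ} {p p' : Fld d} (hp : p ∈ Poly d r) (hp' : p' ∈ Poly d r)
    (h : ∀ q ∈ Poly d r, ∫ x in T, p x * q x = ∫ x in T, p' x * q x) : p = p' := by
  have hc := (contDiff_of_mem_poly hp).continuous
  have hc' := (contDiff_of_mem_poly hp').continuous
  have hs : p - p' ∈ Poly d r := Submodule.sub_mem _ hp hp'
  have hsc : Continuous (p - p') := hc.sub hc'
  have hint : ∫ x in T, (p - p') x ^ 2 = 0 := by
    have h1 := h _ hs
    have i1 : Integrable (fun x => p x * (p - p') x) (vol T) :=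
      integrable_vol_of_continuous hb (hc.mul hsc)
    have i2 : Integrable (fun x => p' x * (p - p') x) (vol T) :=
      integrable_vol_of_continuous hb (hc'.mul hsc)
    rw [← sub_eq_zero, ← integral_sub i1 i2] at h1
    rw [← h1]
    congr 1
    ext x
    simp only [Pi.sub_apply]
    ring
  have hae : ∀ᵐ x ∂(vol T), (p - p') x ^ 2 = 0 :=
    (integral_eq_zero_iff_of_nonneg (fun x => sq_nonneg _)
      (integrable_vol_of_continuous hb (hsc.pow 2))).1 hint
  have hae' : p =ᵐ[vol T] p' := by
    filter_upwards [hae] with x hx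
    exact sub_eq_zero.1 (pow_eq_zero_iff two_ne_zero |>.1 hx)
  have hon : Set.EqOn p p' T :=
    Measure.eqOn_open_of_ae_eq hae' hT hc.continuousOn hc'.continuousOn
  obtain ⟨z, hz⟩ := hne
  exact (analyticOnNhd_of_mem_poly hp).eq_of_eventuallyEq (analyticOnNhd_of_mem_poly hp')
    (hon.eventuallyEq_of_mem (hT.mem_nhds hz))

theorem eq_l2Proj_iff {T : Set (E d)} (hT : IsOpen T) (hne : T.Nonempty)
    (hb : Bornology.IsBounded T) {r : ℕ} {f p : Fld d} (hf : MemLp f 2 (vol T)) :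
    (p ∈ Poly d r ∧ ∀ q ∈ Poly d r, ∫ x in T, p x * q x = ∫ x in T, f x * q x) ↔
      p = l2Proj (vol T) r f := by
  have hP : ∀ q ∈ Poly d r, MemLp q 2 (vol T) := fun q hq =>
    memLp_vol_of_continuous hb (contDiff_of_mem_poly hq).continuous
  have hspec := l2Proj_spec hf hP
  constructor
  · rintro ⟨hp, h⟩
    refine eq_of_integral_mul_eq hT hne hb hp hspec.1 fun q hq => ?_
    rw [h q hq, l2Proj_integral_mul hf hP hq]
  · rintro rfl
    exact ⟨hspec.1, fun q hq => l2Proj_integral_mul hf hP hq⟩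

/-! ### Boundary terms -/

namespace FlatBoundary

variable {T : Set (E d)} {F : Finset (Set (E d))} {n : Set (E d) → E d} {c : Set (E d) → ℝ}

/-- Makes `q * n_j` an admissible weight for `L²` limits on the boundary. The normal is chosen
pointwise, so measurability comes from its being almost everywhere constant on each face. -/
theorem memLp_mul_normal (h : FlatBoundary T F n c) {q : Fld d} (hq : Continuous q) (j : Fin d) :
    MemLp (fun x => q x * outwardNormal T x j) 2 (surf (frontier T)) := by
  have := h.isFiniteMeasure_surf_frontier
  have hK : IsCompact (frontier T) :=
    h.isBounded.isCompact_closure.of_isClosed_subset isClosed_frontier frontier_subset_closure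
  obtain ⟨C, hC⟩ := hK.exists_bound_of_continuousOn hq.continuousOn
  have hm := (h.integrable_mul_outwardNormal hq (EuclideanSpace.single j 1)).1
  simp only [EuclideanSpace.inner_single_right, one_mul, conj_trivial] at hm
  refine MemLp.of_bound hm C ?_
  filter_upwards [h.ae_isOutwardNormalAt, ae_restrict_mem isClosed_frontier.measurableSet]
    with x hx hxT
  have h1 : ‖outwardNormal T x j‖ ≤ 1 := (PiLp.norm_apply_le _ j).trans hx.1.le
  rw [norm_mul]
  exact (mul_le_of_le_one_right (norm_nonneg _) h1).trans (hC x hxT)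

end FlatBoundary

theorem TendstoL2.tendsto_integral_mul {μ : Measure (E d)} {f : ℕ → Fld d} {g w : Fld d}
    (h : TendstoL2 μ f g) (hf : ∀ m, MemLp (f m) 2 μ) (hg : MemLp g 2 μ) (hw : MemLp w 2 μ) :
    Tendsto (fun m => ∫ x, f m x * w x ∂μ) atTop (𝓝 (∫ x, g x * w x ∂μ)) := by
  refine tendsto_integral_of_L1 _ (memLp_mul_integrable hg hw).1
    (Eventually.of_forall fun m => memLp_mul_integrable (hf m) hw) ?_
  have h1 : Tendsto (fun m => eLpNorm (fun x => f m x - g x) 2 μ * eLpNorm w 2 μ) atTop (𝓝 0) := by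
    have := ENNReal.Tendsto.mul_const (b := eLpNorm w 2 μ) h (Or.inr hw.2.ne)
    simpa using this
  refine tendsto_of_tendsto_of_tendsto_of_le_of_le tendsto_const_nhds h1 (fun _ => zero_le)
    fun m => ?_
  have := eLpNorm_smul_le_mul_eLpNorm (p := 2) (q := 2) (r := 1) hw.1 ((hf m).1.sub hg.1)
  rw [eLpNorm_one_eq_lintegral_enorm] at this
  refine le_trans (le_of_eq ?_) this
  refine lintegral_congr fun x => ?_
  simp [sub_mul]

namespace PolyhedralMesh

variable {Ω : Set (E d)} (M : PolyhedralMesh Ω)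

theorem memLp_frontier {T : Set (E d)} (hT : T ∈ M.elems) {w : Fld d}
    (hw : MemLp w 2 (surf M.skeleton)) : MemLp w 2 (surf (frontier T)) :=
  hw.mono_measure (Measure.restrict_mono (M.frontier_subset_skeleton hT) le_rfl)

theorem projFaces_ae_eq {e : Set (E d)} (he : e ∈ M.faces) (r : ℕ) (vb : Fin d → Fld d)
    (i : Fin d) : M.projFaces r vb i =ᵐ[surf e] l2Proj (surf e) r (vb i) := by
  classical
  have hoth : ∀ᵐ x ∂(surf e), ∀ e' ∈ M.faces, e' ≠ e → x ∉ e' := by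
    rw [Filter.eventually_all_finset]
    intro e' he'
    by_cases hee : e' = e
    · simp [hee]
    · have : ∀ᵐ y ∂(surf e), y ∉ e' :=
        measure_eq_zero_iff_ae_notMem.1 (M.face_overlap e he e' he' (Ne.symm hee))
      filter_upwards [this] with y hy _ using hy
  filter_upwards [hoth, ae_restrict_mem (M.face_isCompact he).measurableSet] with x hx hxe
  rw [projFaces, Finset.sum_eq_single_of_mem e he fun e' he' hne =>
    Set.indicator_of_notMem (hx e' he' hne) _, Set.indicator_of_mem hxe]

/-- The boundary values may be replaced by their face-wise projections when tested with
polynomials. -/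
theorem integral_projFaces_mul {T : Set (E d)} (hT : T ∈ M.elems) {r : ℕ} {vb : Fin d → Fld d}
    {i : Fin d} (hvb : MemLp (vb i) 2 (surf M.skeleton)) {q : Fld d} (hq : q ∈ Poly d r)
    (j : Fin d) :
    Integrable (fun x => M.projFaces r vb i x * (q x * outwardNormal T x j)) (surf (frontier T)) ∧
    ∫ x, M.projFaces r vb i x * (q x * outwardNormal T x j) ∂(surf (frontier T)) =
      ∫ x, vb i x * (q x * outwardNormal T x j) ∂(surf (frontier T)) := by
  classical
  obtain ⟨n, c, h⟩ := M.exists_flatBoundary hT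
  have hle : ∀ e ∈ M.faces, surf e ≤ surf M.skeleton := fun e he =>
    Measure.restrict_mono (M.face_subset_skeleton he) le_rfl
  have hqc := (contDiff_of_mem_poly hq).continuous
  have hface : ∀ e ∈ M.faces, ∀ q ∈ Poly d r, MemLp q 2 (surf e) := fun e he q hq =>
    (M.memLp_surf_skeleton_of_continuous (contDiff_of_mem_poly hq).continuous).mono_measure
      (hle e he)
  -- On a single face the normal component is the constant `n e j`, so the remaining weight `q` is a
  -- polynomial to which the face projection applies.
  have hae : ∀ e ∈ M.faces.filter (· ⊆ frontier T),
      (fun x => M.projFaces r vb i x * (q x * outwardNormal T x j)) =ᵐ[surf e]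
        fun x => l2Proj (surf e) r (vb i) x * q x * n e j := by
    intro e he
    filter_upwards [h.outwardNormal_ae_eq he, M.projFaces_ae_eq (Finset.mem_filter.1 he).1 r vb i]
      with x h1 h2
    rw [h1, h2, mul_assoc]
  have hae' : ∀ e ∈ M.faces.filter (· ⊆ frontier T),
      (fun x => vb i x * (q x * outwardNormal T x j)) =ᵐ[surf e]
        fun x => vb i x * q x * n e j := by
    intro e he
    filter_upwards [h.outwardNormal_ae_eq he] with x h1
    rw [h1, mul_assoc]
  have hint : ∀ e ∈ M.faces.filter (· ⊆ frontier T),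
      Integrable (fun x => M.projFaces r vb i x * (q x * outwardNormal T x j)) (surf e) := by
    intro e he
    have heF := (Finset.mem_filter.1 he).1
    have hspec := l2Proj_spec (hvb.mono_measure (hle e heF)) (hface e heF)
    exact ((memLp_mul_integrable (hface e heF _ hspec.1) (hface e heF q hq)).mul_const _).congr
      (hae e he).symm
  refine ⟨?_, ?_⟩
  · rw [h.surf_frontier, integrable_finsetSum_measure]
    exact hint
  · rw [h.integral_surf_frontier hint, h.integral_surf_frontier]
    · refine Finset.sum_congr rfl fun e he => ?_
      have heF := (Finset.mem_filter.1 he).1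
      rw [integral_congr_ae (hae e he), integral_congr_ae (hae' e he), integral_mul_const,
        integral_mul_const,
        l2Proj_integral_mul (hvb.mono_measure (hle e heF)) (hface e heF) hq]
    · intro e he
      have heF := (Finset.mem_filter.1 he).1
      exact ((memLp_mul_integrable (hvb.mono_measure (hle e heF)) (hface e heF q hq)).mul_const
        _).congr (hae' e he).symm

theorem integral_projElem_mul_pd {T : Set (E d)} (hT : T ∈ M.elems) {k : ℕ} {v : Fin d → Fld d}
    {i : Fin d} (hv : MemLp (v i) 2 (vol T)) {q : Fld d} (hq : q ∈ Poly d (k - 1)) (j : Fin d) :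
    Integrable (fun x => projElem T k v i x * pd j q x) (vol T) ∧
    ∫ x in T, projElem T k v i x * pd j q x = ∫ x in T, v i x * pd j q x := by
  have hb := (M.elem_polyhedral T hT).isBounded
  have hP : ∀ q ∈ Poly d k, MemLp q 2 (vol T) := fun q hq =>
    memLp_vol_of_continuous hb (contDiff_of_mem_poly hq).continuous
  have hpd : pd j q ∈ Poly d k := poly_mono (Nat.sub_le k 1) (pd_mem_poly hq j)
  exact ⟨memLp_mul_integrable (hP _ (l2Proj_spec hv hP).1) (hP _ hpd),
    l2Proj_integral_mul hv hP hpd⟩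

/-! ### Integration by parts in `H¹` and `H(div)` -/

/-- Integration by parts for functions in `H¹`. -/
theorem integral_mul_of_isTrace {v : Fin d → Fld d} {G : Fin d → Fin d → Fld d}
    (hH : IsH1 Ω v G) {vb : Fin d → Fld d} (hvb : IsTrace Ω M.skeleton v G vb) {T : Set (E d)}
    (hT : T ∈ M.elems) (i j : Fin d) {q : Fld d} (hq : ContDiff ℝ ∞ q) :
    ∫ x in T, G i j x * q x = - (∫ x in T, v i x * pd j q x) +
      ∫ x, vb i x * (q x * outwardNormal T x j) ∂(surf (frontier T)) := by
  obtain ⟨n, c, h⟩ := M.exists_flatBoundary hT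
  obtain ⟨hvL, φ, hφ, hφv, hφG, hφb⟩ := hvb i
  have hle : vol T ≤ vol Ω := Measure.restrict_mono (M.elem_subset T hT) le_rfl
  have hles : surf (frontier T) ≤ surf M.skeleton :=
    Measure.restrict_mono (M.frontier_subset_skeleton hT) le_rfl
  have hb := h.isBounded
  have l1 := ((hφG j).mono_measure hle).tendsto_integral_mul
    (fun m => memLp_vol_of_continuous hb (contDiff_pd (hφ m) j).continuous)
    ((hH.memLp_grad i j).mono_measure hle) (memLp_vol_of_continuous hb hq.continuous)
  have l2 := (hφv.mono_measure hle).tendsto_integral_mul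
    (fun m => memLp_vol_of_continuous hb (hφ m).continuous)
    ((hH.memLp i).mono_measure hle) (memLp_vol_of_continuous hb (contDiff_pd hq j).continuous)
  have l3 := (hφb.mono_measure hles).tendsto_integral_mul
    (fun m => M.memLp_frontier hT (M.memLp_surf_skeleton_of_continuous (hφ m).continuous))
    (M.memLp_frontier hT hvL) (h.memLp_mul_normal hq.continuous j)
  refine tendsto_nhds_unique l1 ((l2.neg.add l3).congr fun m => ?_)
  rw [h.integral_pd_mul (hφ m) hq j]
  simp only [mul_assoc]

/-- Integration by parts for fields in `H(div)`. -/
theorem integral_mul_of_isNormalTrace {T : Set (E d)} (hT : T ∈ M.elems) {v : Fin d → Fld d}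
    {D : Fld d} (hv : ∀ i, MemLp (v i) 2 (vol T)) (hD : MemLp D 2 (vol T)) {vb : Fin d → Fld d}
    (hvb : IsNormalTrace T v D vb) {q : Fld d} (hq : ContDiff ℝ ∞ q) :
    ∫ x in T, D x * q x = - (∑ i, ∫ x in T, v i x * pd i q x) +
      ∫ x, (∑ i, vb i x * outwardNormal T x i) * q x ∂(surf (frontier T)) := by
  obtain ⟨n, c, h⟩ := M.exists_flatBoundary hT
  have hb := h.isBounded
  have hTm := h.isOpen.measurableSet
  obtain ⟨φ, hφ, hφv, hφD, hφb⟩ := hvb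
  -- The normal trace is tested only with compactly supported functions, so `q` is cut off away from
  -- `closure T`.
  obtain ⟨R, hR0, hR⟩ := hb.closure.subset_ball_lt 0 0
  let χ : ContDiffBump (0 : E d) := ⟨R, R + 1, hR0, by linarith⟩
  set ψ : Fld d := fun x => χ x * q x with hψ
  have hψq : ∀ x ∈ closure T, ψ =ᶠ[𝓝 x] q := fun x hx => by
    filter_upwards [χ.eventuallyEq_one_of_mem_ball (hR hx)] with y hy
    simp [hψ, hy]
  have hψs : ContDiff ℝ ∞ ψ := χ.contDiff.mul hq
  have hψt : IsTest Set.univ ψ := ⟨hψs, χ.hasCompactSupport.mul_right, Set.subset_univ _⟩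
  have hpd : ∀ i, ∀ x ∈ T, pd i ψ x = pd i q x := fun i x hx => by
    simp only [pd, (hψq x (subset_closure hx)).fderiv_eq]
  have hcont : ∀ m, Continuous fun x => ∑ i, pd i (φ m i) x := fun m =>
    continuous_finsetSum _ fun i _ => (contDiff_pd (hφ m i) i).continuous
  have l1 := hφD.tendsto_integral_mul (fun m => memLp_vol_of_continuous hb (hcont m)) hD
    (memLp_vol_of_continuous hb hψs.continuous)
  have l2 := tendsto_finsetSum Finset.univ fun i (_ : i ∈ Finset.univ) =>
    (hφv i).tendsto_integral_mul
      (fun m => memLp_vol_of_continuous hb (hφ m i).continuous) (hv i)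
      (memLp_vol_of_continuous hb (contDiff_pd hψs i).continuous)
  have l3 := hφb ψ hψt
  have key := tendsto_nhds_unique l1 ((l2.neg.add l3).congr fun m => ?_)
  · have e1 : ∫ x in T, D x * q x = ∫ x in T, D x * ψ x :=
      setIntegral_congr_fun hTm fun x hx => by
        simp only [(hψq x (subset_closure hx)).self_of_nhds]
    have e2 : ∀ i, ∫ x in T, v i x * pd i q x = ∫ x in T, v i x * pd i ψ x := fun i =>
      setIntegral_congr_fun hTm fun x hx => by simp only [hpd i x hx]
    have e3 : ∫ x, (∑ i, vb i x * outwardNormal T x i) * q x ∂(surf (frontier T)) =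
        ∫ x, (∑ i, vb i x * outwardNormal T x i) * ψ x ∂(surf (frontier T)) :=
      setIntegral_congr_fun isClosed_frontier.measurableSet fun x hx => by
        simp only [(hψq x (frontier_subset_closure hx)).self_of_nhds]
    rw [e1, e3, key]
    simp only [e2]
  · have i1 : ∀ i, Integrable (fun x => pd i (φ m i) x * ψ x) (vol T) := fun i =>
      integrable_vol_of_continuous hb ((contDiff_pd (hφ m i) i).continuous.mul hψs.continuous)
    have i2 : ∀ i, Integrable (fun x => φ m i x * ψ x * outwardNormal T x i)
        (surf (frontier T)) := fun i => by
      have := h.integrable_mul_outwardNormal ((hφ m i).continuous.mul hψs.continuous)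
        (EuclideanSpace.single i 1)
      simpa [EuclideanSpace.inner_single_right] using this
    have e1 : ∫ x in T, (∑ i, pd i (φ m i) x) * ψ x =
        ∑ i, ∫ x in T, pd i (φ m i) x * ψ x := by
      simp only [Finset.sum_mul]
      exact integral_finsetSum _ fun i _ => i1 i
    have e2 : ∫ x, (∑ i, φ m i x * outwardNormal T x i) * ψ x ∂(surf (frontier T)) =
        ∑ i, ∫ x, φ m i x * ψ x * outwardNormal T x i ∂(surf (frontier T)) := by
      rw [← integral_finsetSum _ fun i _ => i2 i]
      congr 1
      ext x
      rw [Finset.sum_mul]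
      exact Finset.sum_congr rfl fun i _ => by ring
    rw [e1, e2, ← Finset.sum_neg_distrib, ← Finset.sum_add_distrib]
    exact Finset.sum_congr rfl fun i _ => (h.integral_pd_mul (hφ m i) hψs i).symm

/-! ### Commutation of the projections with the discrete weak operators -/

/-- The right-hand side of the definition of the discrete weak divergence of `Q_h v`. -/
theorem divergence_functional_proj {T : Set (E d)} (hT : T ∈ M.elems) {k : ℕ}
    {v vb : Fin d → Fld d} (hv : ∀ i, MemLp (v i) 2 (vol T))
    (hvb : ∀ i, MemLp (vb i) 2 (surf M.skeleton)) {q : Fld d} (hq : q ∈ Poly d (k - 1)) :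
    - (∫ x in T, ∑ i, projElem T k v i x * pd i q x) +
      ∫ x, (∑ i, M.projFaces (k - 1) vb i x * outwardNormal T x i) * q x ∂(surf (frontier T)) =
    - (∑ i, ∫ x in T, v i x * pd i q x) +
      ∑ i, ∫ x, vb i x * (q x * outwardNormal T x i) ∂(surf (frontier T)) := by
  have hA := fun i => M.integral_projElem_mul_pd hT (hv i) hq i
  have hB := fun i => M.integral_projFaces_mul hT (hvb i) hq i
  congr 1
  · rw [integral_finsetSum _ fun i _ => (hA i).1]
    exact congrArg Neg.neg (Finset.sum_congr rfl fun i _ => (hA i).2)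
  · rw [← Finset.sum_congr rfl fun i _ => (hB i).2, ← integral_finsetSum _ fun i _ => (hB i).1]
    congr 1
    ext x
    rw [Finset.sum_mul]
    exact Finset.sum_congr rfl fun i _ => by ring

/-- Common to the `H¹` and `H(div)` statements, which differ only in how the integration by parts
`hibp` is obtained. -/
theorem isDiscreteWeakDivergence_iff {T : Set (E d)} (hT : T ∈ M.elems) {k : ℕ}
    {v vb : Fin d → Fld d} {D : Fld d} (hv : ∀ i, MemLp (v i) 2 (vol T))
    (hvb : ∀ i, MemLp (vb i) 2 (surf M.skeleton)) (hD : MemLp D 2 (vol T))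
    (hibp : ∀ q ∈ Poly d (k - 1), ∫ x in T, D x * q x = - (∑ i, ∫ x in T, v i x * pd i q x) +
      ∑ i, ∫ x, vb i x * (q x * outwardNormal T x i) ∂(surf (frontier T))) (p : Fld d) :
    IsDiscreteWeakDivergence T (k - 1) (projElem T k v) (M.projFaces (k - 1) vb) p ↔
      p = l2Proj (vol T) (k - 1) D := by
  have hpoly := M.elem_polyhedral T hT
  rw [← eq_l2Proj_iff hpoly.isOpen hpoly.isConnected.nonempty hpoly.isBounded hD,
    IsDiscreteWeakDivergence]
  refine and_congr_right fun _ => forall₂_congr fun q hq => ?_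
  rw [M.divergence_functional_proj hT hv hvb hq, hibp q hq]

theorem gradient_functional_proj {v : Fin d → Fld d} {G : Fin d → Fin d → Fld d}
    (hH : IsH1 Ω v G) {vb : Fin d → Fld d} (hvb : IsTrace Ω M.skeleton v G vb) {T : Set (E d)}
    (hT : T ∈ M.elems) {k : ℕ} {q : Fin d → Fin d → Fld d} (hq : ∀ i j, q i j ∈ Poly d (k - 1)) :
    - (∫ x in T, ∑ i, projElem T k v i x * ∑ j, pd j (q i j) x) +
      ∫ x, (∑ i, M.projFaces (k - 1) vb i x * ∑ j, q i j x * outwardNormal T x j)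
        ∂(surf (frontier T)) = ∑ i, ∑ j, ∫ x in T, G i j x * q i j x := by
  have hle : vol T ≤ vol Ω := Measure.restrict_mono (M.elem_subset T hT) le_rfl
  have hA := fun i j =>
    M.integral_projElem_mul_pd hT ((hH.memLp i).mono_measure hle) (hq i j) j
  have hB := fun i j => M.integral_projFaces_mul hT (hvb i).1 (hq i j) j
  simp only [Finset.mul_sum]
  rw [integral_finsetSum _ fun i _ => integrable_finsetSum _ fun j _ => (hA i j).1,
    integral_finsetSum _ fun i _ => integrable_finsetSum _ fun j _ => (hB i j).1,
    ← Finset.sum_neg_distrib, ← Finset.sum_add_distrib]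
  refine Finset.sum_congr rfl fun i _ => ?_
  rw [integral_finsetSum _ fun j _ => (hA i j).1, integral_finsetSum _ fun j _ => (hB i j).1,
    ← Finset.sum_neg_distrib, ← Finset.sum_add_distrib]
  refine Finset.sum_congr rfl fun j _ => ?_
  rw [(hA i j).2, (hB i j).2,
    M.integral_mul_of_isTrace hH hvb hT i j (contDiff_of_mem_poly (hq i j))]

theorem isDiscreteWeakGradient_iff {v : Fin d → Fld d} {G : Fin d → Fin d → Fld d}
    (hH : IsH1 Ω v G) {vb : Fin d → Fld d} (hvb : IsTrace Ω M.skeleton v G vb) {T : Set (E d)}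
    (hT : T ∈ M.elems) {k : ℕ} (A : Fin d → Fin d → Fld d) :
    IsDiscreteWeakGradient T (k - 1) (projElem T k v) (M.projFaces (k - 1) vb) A ↔
      A = projMatrix T (k - 1) G := by
  classical
  have hpoly := M.elem_polyhedral T hT
  have hle : vol T ≤ vol Ω := Measure.restrict_mono (M.elem_subset T hT) le_rfl
  have hiff := fun i j => eq_l2Proj_iff (r := k - 1) (p := A i j) hpoly.isOpen
    hpoly.isConnected.nonempty hpoly.isBounded ((hH.memLp_grad i j).mono_measure hle)
  have hlhs : (∀ i j, A i j ∈ Poly d (k - 1)) → ∀ q : Fin d → Fin d → Fld d,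
      (∀ i j, q i j ∈ Poly d (k - 1)) → ∫ x in T, (∑ i, ∑ j, A i j x * q i j x) =
        ∑ i, ∑ j, ∫ x in T, A i j x * q i j x := by
    intro hA q hq
    have hint : ∀ i j, Integrable (fun x => A i j x * q i j x) (vol T) := fun i j =>
      integrable_vol_of_continuous hpoly.isBounded
        ((contDiff_of_mem_poly (hA i j)).continuous.mul (contDiff_of_mem_poly (hq i j)).continuous)
    rw [integral_finsetSum _ fun i _ => integrable_finsetSum _ fun j _ => hint i j]
    exact Finset.sum_congr rfl fun i _ => integral_finsetSum _ fun j _ => hint i j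
  constructor
  · rintro ⟨hA, h⟩
    funext i j
    refine (hiff i j).1 ⟨hA i j, fun p hp => ?_⟩
    -- Matrix tests with a single nonzero entry decouple the identity into scalar projections.
    set q : Fin d → Fin d → Fld d := fun i' j' => if i' = i ∧ j' = j then p else 0 with hqdef
    have hq : ∀ i' j', q i' j' ∈ Poly d (k - 1) := by
      intro i' j'
      simp only [hqdef]
      split_ifs
      · exact hp
      · exact Submodule.zero_mem _
    have hsingle : ∀ B : Fin d → Fin d → Fld d,
        ∑ i', ∑ j', ∫ x in T, B i' j' x * q i' j' x = ∫ x in T, B i j x * p x := by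
      intro B
      rw [Finset.sum_eq_single_of_mem i (Finset.mem_univ i), Finset.sum_eq_single_of_mem j
        (Finset.mem_univ j)]
      · simp [hqdef]
      · intro j' _ hj
        simp [hqdef, hj]
      · intro i' _ hi
        simp [hqdef, hi]
    have := h q hq
    rw [hlhs hA q hq, M.gradient_functional_proj hH hvb hT hq, hsingle, hsingle] at this
    exact this
  · intro hAG
    have h := fun i j => (hiff i j).2 (congrFun (congrFun hAG i) j)
    refine ⟨fun i j => (h i j).1, fun q hq => ?_⟩
    rw [hlhs (fun i j => (h i j).1) q hq, M.gradient_functional_proj hH hvb hT hq]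
    exact Finset.sum_congr rfl fun i _ => Finset.sum_congr rfl fun j _ => (h i j).2 _ (hq i j)

end PolyhedralMesh

end WG

end

theorem mainTheorem5 (d : ℕ) (hd : d = 2 ∨ d = 3) (Ω : Set (WG.E d))
    (hΩ : WG.IsPolyhedralDomain Ω) (M : WG.PolyhedralMesh Ω) (k : ℕ) (hk : 1 ≤ k) :
    (∀ (v : Fin d → WG.Fld d) (G : Fin d → Fin d → WG.Fld d), WG.IsH1 Ω v G →
      (∃ vb, WG.IsTrace Ω M.skeleton v G vb) ∧
      ∀ vb, WG.IsTrace Ω M.skeleton v G vb → ∀ T ∈ M.elems,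
        (∀ A, WG.IsDiscreteWeakGradient T (k - 1) (WG.projElem T k v) (M.projFaces (k - 1) vb) A ↔
          A = WG.projMatrix T (k - 1) G) ∧
        (∀ p, WG.IsDiscreteWeakDivergence T (k - 1) (WG.projElem T k v)
            (M.projFaces (k - 1) vb) p ↔
          p = WG.l2Proj (WG.vol T) (k - 1) (fun x => ∑ i, G i i x))) ∧
    (∀ (v : Fin d → WG.Fld d) (D : WG.Fld d), WG.IsHdiv Ω v D →
      ∀ vb : Fin d → WG.Fld d, (∀ i, MemLp (vb i) 2 (WG.surf M.skeleton)) →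
      (∀ T ∈ M.elems, WG.IsNormalTrace T v D vb) → ∀ T ∈ M.elems,
        ∀ p, WG.IsDiscreteWeakDivergence T (k - 1) (WG.projElem T k v)
            (M.projFaces (k - 1) vb) p ↔
          p = WG.l2Proj (WG.vol T) (k - 1) D) := by
  have hle : ∀ T ∈ M.elems, WG.vol T ≤ WG.vol Ω := fun T hT =>
    Measure.restrict_mono (M.elem_subset T hT) le_rfl
  refine ⟨fun v G hH => ⟨M.exists_isTrace hΩ hH, fun vb hvb T hT =>
    ⟨M.isDiscreteWeakGradient_iff hH hvb hT, ?_⟩⟩, fun v D hv vb hvb htr T hT => ?_⟩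
  · have hG : ∀ i, MemLp (G i i) 2 (WG.vol T) := fun i =>
      (hH.memLp_grad i i).mono_measure (hle T hT)
    -- The divergence is the trace of the gradient, so the required formula is the sum of the
    -- diagonal cases of `integral_mul_of_isTrace`.
    refine M.isDiscreteWeakDivergence_iff hT (fun i => (hH.memLp i).mono_measure (hle T hT))
      (fun i => (hvb i).1) (memLp_finsetSum _ fun i _ => hG i) fun q hq => ?_
    have hqs := WG.contDiff_of_mem_poly hq
    have hb := (M.elem_polyhedral T hT).isBounded
    simp only [Finset.sum_mul]
    rw [integral_finsetSum _ fun i _ => WG.memLp_mul_integrable (hG i)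
      (WG.memLp_vol_of_continuous hb hqs.continuous), ← Finset.sum_neg_distrib,
      ← Finset.sum_add_distrib]
    exact Finset.sum_congr rfl fun i _ => M.integral_mul_of_isTrace hH hvb hT i i hqs
  · have hvT : ∀ i, MemLp (v i) 2 (WG.vol T) := fun i => (hv.memLp i).mono_measure (hle T hT)
    have hDT := hv.memLp_div.mono_measure (hle T hT)
    refine M.isDiscreteWeakDivergence_iff hT hvT hvb hDT fun q hq => ?_
    have hqs := WG.contDiff_of_mem_poly hq
    obtain ⟨n, c, h⟩ := M.exists_flatBoundary hT
    rw [M.integral_mul_of_isNormalTrace hT hvT hDT (htr T hT) hqs,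
      ← integral_finsetSum _ fun i _ => WG.memLp_mul_integrable (M.memLp_frontier hT (hvb i))
        (h.memLp_mul_normal hqs.continuous i)]
    congr 2
    ext x
    rw [Finset.sum_mul]
    exact Finset.sum_congr rfl fun i _ => by ring
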